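/- **Theorem (Uniqueness).** Let $N\ge 1$, and let $V=V^*\in L^1(0,1)$ be an $N\times N$ complex matrix-valued potential. Let $H\psi=-\psi''+V\psi$ be the self-adjoint operator in $L^2(0,1)^N$ with the boundary conditions $\psi(0)=\psi(1)=0$; let $\lambda_1<\lambda_2<\dots$ be its distinct eigenvalues and $k_\alpha$ the multiplicity of $\lambda_\alpha$ (the dimension of the eigenspace). Let $\varphi(x,\lambda)$ be the $N\times N$ matrix solution of $-\varphi''+V\varphi=\lambda\varphi$ with $\varphi(0,\lambda)=0$, $\varphi'(0,\lambda)=I$. For each $\alpha\ge 1$ put $$\mathcal E_\alpha=\operatorname{Ker}\varphi(1,\lambda_\alpha)\subset\mathbb C^N,\qquad S_\alpha=\int_0^1\varphi^*(t,\lambda_\alpha)\varphi(t,\lambda_\alpha)\,dt,\qquad g_\alpha=(P_\alpha S_\alpha P_\alpha)\big|_{\mathcal E_\alpha}:\mathcal E_\alpha\to\mathcal E_\alpha,$$ where $P_\alpha$ is the orthogonal projector of $\mathbb C^N$ onto $\mathcal E_\alpha$. Let $\widetilde V=\widetilde V^*\in L^1(0,1)$ be another $N\times N$ potential, and let $\widetilde\lambda_\alpha,\widetilde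 k_\alpha,\widetilde{\mathcal E}_\alpha,\widetilde g_\alpha$ be the corresponding objects for $\widetilde V$. If $\widetilde\lambda_\alpha=\lambda_\alpha$, $\widetilde k_\alpha=k_\alpha$, $\widetilde{\mathcal E}_\alpha=\mathcal E_\alpha$ and $\widetilde g_\alpha=g_\alpha$ for all $\alpha\ge1$, then $\widetilde V=V$ (almost everywhere on $(0,1)$). -/

import Mathlib

noncomputable section

namespace MatrixSL

open MeasureTheory Set
open scoped Matrix

/-- A self-adjoint `N × N` matrix potential `V = V* ∈ L¹(0,1)`.  Only the values of `V` almost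
everywhere on `(0,1)` matter. -/
structure IsPotential {N : ℕ} (V : ℝ → Matrix (Fin N) (Fin N) ℂ) : Prop where
  integrable : ∀ i j, IntegrableOn (fun x => V x i j) (Ioo 0 1) volume
  selfAdjoint : ∀ᵐ x ∂(volume.restrict (Ioo (0 : ℝ) 1)), (V x)ᴴ = V x

/-- `ψ` is a solution on `[0,1]` of `-ψ'' + V ψ = lam ψ` with derivative `ψ' = dψ`, in the usual
sense for integrable coefficients: `ψ` is differentiable on `[0,1]` (one-sidedly at the end
points), and `ψ'` is absolutely continuous with `(ψ')' = V ψ - lam ψ` almost everywhere, that is,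
`ψ'` is the integral of the integrable function `V ψ - lam ψ`. -/
structure IsSolution {N : ℕ} (V : ℝ → Matrix (Fin N) (Fin N) ℂ) (lam : ℂ)
    (ψ dψ : ℝ → Fin N → ℂ) : Prop where
  hasDeriv : ∀ x ∈ Icc (0 : ℝ) 1, HasDerivWithinAt ψ (dψ x) (Icc 0 1) x
  integrable : IntervalIntegrable (fun t => V t *ᵥ ψ t - lam • ψ t) volume 0 1
  integral_eq : ∀ x ∈ Icc (0 : ℝ) 1,
    dψ x = dψ 0 + ∫ t in (0 : ℝ)..x, (V t *ᵥ ψ t - lam • ψ t)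

/-- The space of solutions on `[0,1]` of `-ψ'' + V ψ = lam ψ`, `ψ(0) = ψ(1) = 0`; that is, the
kernel of `H - lam`. -/
def eigenspace {N : ℕ} (V : ℝ → Matrix (Fin N) (Fin N) ℂ) (lam : ℂ) :
    Submodule ℂ (Icc (0 : ℝ) 1 → Fin N → ℂ) where
  carrier := {u | ∃ ψ dψ : ℝ → Fin N → ℂ, IsSolution V lam ψ dψ ∧ ψ 0 = 0 ∧ ψ 1 = 0 ∧
    ∀ x : Icc (0 : ℝ) 1, u x = ψ x}
  zero_mem' := by
    refine ⟨0, 0, ⟨?_, ?_, ?_⟩, rfl, rfl, fun _ => rfl⟩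
    · intro x _
      exact hasDerivWithinAt_const x _ (0 : Fin N → ℂ)
    · simp
    · intro x _
      simp
  add_mem' := by
    rintro u v ⟨ψ, dψ, h, h0, h1, hu⟩ ⟨χ, dχ, k, k0, k1, hv⟩
    have e : (fun t => V t *ᵥ (ψ + χ) t - lam • (ψ + χ) t) =
        fun t => (V t *ᵥ ψ t - lam • ψ t) + (V t *ᵥ χ t - lam • χ t) := by
      funext t
      simp only [Pi.add_apply, Matrix.mulVec_add, smul_add]
      abel
    refine ⟨ψ + χ, dψ + dχ, ⟨?_, ?_, ?_⟩, by simp [h0, k0], by simp [h1, k1],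
      fun x => by simp [hu x, hv x]⟩
    · intro x hx
      exact (h.hasDeriv x hx).add (k.hasDeriv x hx)
    · rw [e]
      exact h.integrable.add k.integrable
    · intro x hx
      have hs : uIcc 0 x ⊆ uIcc (0 : ℝ) 1 := by
        rw [uIcc_of_le hx.1, uIcc_of_le zero_le_one]
        exact Icc_subset_Icc_right hx.2
      rw [e, intervalIntegral.integral_add (h.integrable.mono_set hs)
        (k.integrable.mono_set hs), Pi.add_apply, Pi.add_apply, h.integral_eq x hx,
        k.integral_eq x hx]
      abel
  smul_mem' := by
    rintro c u ⟨ψ, dψ, h, h0, h1, hu⟩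
    have e : (fun t => V t *ᵥ (c • ψ) t - lam • (c • ψ) t) =
        fun t => c • (V t *ᵥ ψ t - lam • ψ t) := by
      funext t
      simp only [Pi.smul_apply, Matrix.mulVec_smul, smul_sub, smul_comm lam c]
    refine ⟨c • ψ, c • dψ, ⟨?_, ?_, ?_⟩, by simp [h0], by simp [h1], fun x => by simp [hu x]⟩
    · intro x hx
      exact (h.hasDeriv x hx).const_smul c
    · rw [e]
      exact h.integrable.smul c
    · intro x hx
      rw [e, intervalIntegral.integral_smul, Pi.smul_apply, Pi.smul_apply, h.integral_eq x hx,
        smul_add]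

/-- The eigenvalues `λ_1 < λ_2 < ...` of the operator `H` (real, since `H` is self-adjoint). -/
def eigenvalues {N : ℕ} (V : ℝ → Matrix (Fin N) (Fin N) ℂ) : Set ℝ :=
  {lam | eigenspace V (lam : ℂ) ≠ ⊥}

/-- The multiplicity of `lam`: the number of linearly independent eigenfunctions. -/
def multiplicity {N : ℕ} (V : ℝ → Matrix (Fin N) (Fin N) ℂ) (lam : ℝ) : ℕ :=
  Module.finrank ℂ (eigenspace V (lam : ℂ))

/-- The isospectral set of `V`: all potentials with the same eigenvalues and the same
multiplicities. -/
def Iso {N : ℕ} (V : ℝ → Matrix (Fin N) (Fin N) ℂ) : Set (ℝ → Matrix (Fin N) (Fin N) ℂ) :=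
  {W | IsPotential W ∧ eigenvalues W = eigenvalues V ∧
    ∀ lam ∈ eigenvalues V, multiplicity W lam = multiplicity V lam}

/-- `Φ` is a matrix solution of `-Φ'' + V Φ = lam Φ` on `[0,1]` (each column is a solution) with
`Φ(0) = 0`, `Φ'(0) = I`. -/
def IsSineSolution {N : ℕ} (V : ℝ → Matrix (Fin N) (Fin N) ℂ) (lam : ℂ)
    (Φ : ℝ → Matrix (Fin N) (Fin N) ℂ) : Prop :=
  ∃ dΦ : ℝ → Matrix (Fin N) (Fin N) ℂ,
    (∀ j, IsSolution V lam (fun x i => Φ x i j) (fun x i => dΦ x i j)) ∧ Φ 0 = 0 ∧ dΦ 0 = 1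

/-- The matrix solution `φ(x, lam)` with `φ(0, lam) = 0`, `φ'(0, lam) = I`.  For a potential
`V ∈ L¹(0,1)` it exists and is unique on `[0,1]`; its values elsewhere are irrelevant. -/
def phi {N : ℕ} (V : ℝ → Matrix (Fin N) (Fin N) ℂ) (lam : ℂ) :
    ℝ → Matrix (Fin N) (Fin N) ℂ :=
  Classical.epsilon (IsSineSolution V lam)

/-- `S = ∫₀¹ φ*(t, lam) φ(t, lam) dt`, entry by entry. -/
def S {N : ℕ} (V : ℝ → Matrix (Fin N) (Fin N) ℂ) (lam : ℝ) : Matrix (Fin N) (Fin N) ℂ :=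
  Matrix.of fun i j => ∫ t in (0 : ℝ)..1, ((phi V (lam : ℂ) t)ᴴ * phi V (lam : ℂ) t) i j

/-- The subspace `E = Ker φ(1, lam)` of `ℂ^N`. -/
def E {N : ℕ} (V : ℝ → Matrix (Fin N) (Fin N) ℂ) (lam : ℝ) :
    Submodule ℂ (EuclideanSpace ℂ (Fin N)) :=
  LinearMap.ker (Matrix.toEuclideanLin (phi V (lam : ℂ) 1))

/-- The orthogonal projector `P` of `ℂ^N` onto `E`. -/
def P {N : ℕ} (V : ℝ → Matrix (Fin N) (Fin N) ℂ) (lam : ℝ) :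
    EuclideanSpace ℂ (Fin N) →ₗ[ℂ] EuclideanSpace ℂ (Fin N) :=
  ((E V lam).starProjection : EuclideanSpace ℂ (Fin N) →L[ℂ] EuclideanSpace ℂ (Fin N))

/-- `G = P S P`. -/
def G {N : ℕ} (V : ℝ → Matrix (Fin N) (Fin N) ℂ) (lam : ℝ) :
    EuclideanSpace ℂ (Fin N) →ₗ[ℂ] EuclideanSpace ℂ (Fin N) :=
  P V lam ∘ₗ Matrix.toEuclideanLin (S V lam) ∘ₗ P V lam

/-- The norming operator `g : E → E`, the restriction of `G` to `E`. -/
def g {N : ℕ} (V : ℝ → Matrix (Fin N) (Fin N) ℂ) (lam : ℝ) : E V lam →ₗ[ℂ] E V lam :=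
  (G V lam).restrict (fun _ _ => Submodule.starProjection_apply_mem _ _)

end MatrixSL

end

open MeasureTheory Set Filter
open scoped Matrix Topology

noncomputable section

set_option linter.unusedSectionVars false

/-! The proof is the method of spectral mappings. Write `φ`, `θ` for the solutions with initial data
`(0, 1)`, `(1, 0)`, and `Δ(λ) = φ(1, λ)`. The Weyl solution `Ψ = θ + φ M` satisfies `Ψ(0) = 1`,
`Ψ(1) = 0`, with Weyl function `M = -Δ⁻¹ θ(1, ·)`.

The spectral data fix the principal parts of `M`. At a real `λ₀`, let `p` be the projection onto
`Ker Δ(λ₀)` and put `C(λ) = p ∫ φ(λ₀)* φ(λ) + Δ(λ₀)* Δ(λ)` (`poleOp`). The Lagrange identity gives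
`C(λ) M(λ) = -p/(λ - λ₀) + (entire)`, and `C(λ₀) = p S + Δ* Δ` is invertible. So `M` has at most a
simple pole at `λ₀` with residue `-R`, where `C(λ₀) R = p`. Since `R = p R`, only `p S p` enters;
hence equal `E` and `g` give equal principal parts, and `D = M_W - M_V` is entire
(`samePoles_of_proj`, `exists_entire_weylM_sub`).

Consider the combinations `Ψ_W φ_V* - φ_W Ψ_V*` and `φ_W Ψ_V'* - Ψ_W φ_V'* + 1`, where the starred
functions are taken at the conjugate parameter. In them `M_W` and `M_V` occur only through `D`, so
both are entire in `λ`. On the circles `|k| = (n + 1/2) π`, `λ = k²`, the growth of `φ` and the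
decay of `Ψ` cancel and both are `O(1/|k|)` (`norm_transition_le`). By the maximum principle both
vanish. The Wronskian identities for `V` then turn this into `φ_W = φ_V` (`sol_eq_of_samePoles`).
Finally `(W - V) φ = 0` almost everywhere, and `φ(x, i)` is invertible for `x > 0`
(`ae_eq_of_sol_eq`).

The analysis takes place in a Banach algebra `A`, with an involution and finite dimension where
needed. Matrices enter at the end, with the operator norm, which supplies the C*-identity and, for
`N ≥ 1`, `‖1‖ = 1`. -/

namespace MatrixSL

/-! ### Absolutely continuous functions as primitives of integrable ones -/

section Primitive

variable {E F : Type*} [NormedAddCommGroup E] [NormedSpace ℝ E]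
  [NormedAddCommGroup F] [NormedSpace ℝ F]

/-- `F` is on `[0,1]` a primitive of the integrable function `f`. -/
structure IsPrim (F f : ℝ → E) : Prop where
  int : IntervalIntegrable f volume 0 1
  eq : ∀ x ∈ Icc (0 : ℝ) 1, F x = F 0 + ∫ t in (0 : ℝ)..x, f t

lemma intervalIntegrable_sub {f : ℝ → E} (hf : IntervalIntegrable f volume 0 1) {x y : ℝ}
    (hx : x ∈ Icc (0 : ℝ) 1) (hy : y ∈ Icc (0 : ℝ) 1) : IntervalIntegrable f volume x y :=
  hf.mono_set (by rw [uIcc_of_le zero_le_one]; exact uIcc_subset_Icc hx hy)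

namespace IsPrim

lemma sub_eq {F f : ℝ → E} (h : IsPrim F f) {x y : ℝ} (hx : x ∈ Icc (0 : ℝ) 1)
    (hy : y ∈ Icc (0 : ℝ) 1) : F y - F x = ∫ t in x..y, f t := by
  have h0 : (0 : ℝ) ∈ Icc (0 : ℝ) 1 := by simp
  rw [h.eq x hx, h.eq y hy, ← intervalIntegral.integral_interval_sub_left
    (intervalIntegrable_sub h.int h0 hy) (intervalIntegrable_sub h.int h0 hx)]
  abel

lemma continuousOn {F f : ℝ → E} (h : IsPrim F f) : ContinuousOn F (Icc 0 1) := by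
  have := intervalIntegral.continuousOn_primitive_interval' h.int
    (a := 0) (by simp)
  rw [uIcc_of_le zero_le_one] at this
  exact (continuousOn_const.add this).congr h.eq

lemma intervalIntegrable {F f : ℝ → E} (h : IsPrim F f) : IntervalIntegrable F volume 0 1 :=
  ContinuousOn.intervalIntegrable (by rw [uIcc_of_le zero_le_one]; exact h.continuousOn)

lemma congr {F G f g : ℝ → E} (h : IsPrim F f) (hF : ∀ x ∈ Icc (0 : ℝ) 1, F x = G x)
    (hf : ∀ x ∈ Icc (0 : ℝ) 1, f x = g x) : IsPrim G g := by
  refine ⟨h.int.congr ?_, fun x hx => ?_⟩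
  · intro x hx
    rw [uIoc_of_le zero_le_one] at hx
    exact hf x (Ioc_subset_Icc_self hx)
  · rw [← hF x hx, ← hF 0 (by simp), h.eq x hx]
    congr 1
    refine intervalIntegral.integral_congr fun t ht => hf t ?_
    rw [uIcc_of_le hx.1] at ht
    exact ⟨ht.1, ht.2.trans hx.2⟩

lemma congr_ae {F f g : ℝ → E} (h : IsPrim F f)
    (hf : ∀ᵐ x, x ∈ Ioc (0 : ℝ) 1 → f x = g x) : IsPrim F g := by
  have hf' : ∀ᵐ x ∂(volume.restrict (uIoc (0 : ℝ) 1)), f x = g x := by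
    rw [uIoc_of_le zero_le_one]
    exact (ae_restrict_iff' measurableSet_Ioc).2 hf
  refine ⟨h.int.congr_ae hf', fun x hx => ?_⟩
  rw [h.eq x hx]
  congr 1
  apply intervalIntegral.integral_congr_ae
  filter_upwards [hf] with t ht ht'
  rw [uIoc_of_le hx.1] at ht'
  exact ht ⟨ht'.1, ht'.2.trans hx.2⟩

lemma integral {f : ℝ → E} (a : E) (hf : IntervalIntegrable f volume 0 1) :
    IsPrim (fun x => a + ∫ t in (0 : ℝ)..x, f t) f :=
  ⟨hf, fun x _ => by simp⟩

lemma const (a : E) : IsPrim (fun _ => a) (fun _ => (0 : E)) :=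
  ⟨by simp, fun x _ => by simp⟩

lemma add {F G f g : ℝ → E} (h : IsPrim F f) (k : IsPrim G g) :
    IsPrim (fun x => F x + G x) (fun x => f x + g x) := by
  refine ⟨h.int.add k.int, fun x hx => ?_⟩
  have h0 : (0 : ℝ) ∈ Icc (0 : ℝ) 1 := by simp
  rw [intervalIntegral.integral_add (intervalIntegrable_sub h.int h0 hx)
    (intervalIntegrable_sub k.int h0 hx), h.eq x hx, k.eq x hx]
  abel

variable [CompleteSpace E] [CompleteSpace F]

lemma clm {G g : ℝ → E} (h : IsPrim G g) (T : E →L[ℝ] F) :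
    IsPrim (fun x => T (G x)) (fun x => T (g x)) := by
  have h0 : (0 : ℝ) ∈ Icc (0 : ℝ) 1 := by simp
  refine ⟨⟨T.integrable_comp h.int.1, T.integrable_comp h.int.2⟩, fun x hx => ?_⟩
  rw [h.eq x hx, map_add, T.intervalIntegral_comp_comm (intervalIntegrable_sub h.int h0 hx)]

lemma neg {G g : ℝ → E} (h : IsPrim G g) : IsPrim (fun x => -G x) (fun x => -g x) :=
  h.clm (-ContinuousLinearMap.id ℝ E)

lemma sub {G H g h : ℝ → E} (hG : IsPrim G g) (hH : IsPrim H h) :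
    IsPrim (fun x => G x - H x) (fun x => g x - h x) := by
  simpa only [sub_eq_add_neg] using hG.add hH.neg

lemma of_hasDerivWithinAt {F f : ℝ → E}
    (h : ∀ x ∈ Icc (0 : ℝ) 1, HasDerivWithinAt F (f x) (Icc 0 1) x)
    (hf : ContinuousOn f (Icc 0 1)) : IsPrim F f := by
  have hi : IntervalIntegrable f volume 0 1 :=
    ContinuousOn.intervalIntegrable (by rwa [uIcc_of_le zero_le_one])
  refine ⟨hi, fun x hx => ?_⟩
  have h0 : (0 : ℝ) ∈ Icc (0 : ℝ) 1 := by simp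
  rw [intervalIntegral.integral_eq_sub_of_hasDeriv_right_of_le hx.1
    (fun t ht => ((h t ⟨ht.1, ht.2.trans hx.2⟩).continuousWithinAt).mono
      (Icc_subset_Icc_right hx.2)) (f' := f) (fun t ht => ?_) (intervalIntegrable_sub hi h0 hx)]
  · abel
  · exact ((h t ⟨ht.1.le, ht.2.le.trans hx.2⟩).hasDerivAt
      (Icc_mem_nhds ht.1 (ht.2.trans_le hx.2))).hasDerivWithinAt

lemma of_hasDerivAt {F f : ℝ → E} (h : ∀ x, HasDerivAt F (f x) x) (hf : Continuous f) :
    IsPrim F f :=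
  of_hasDerivWithinAt (fun x _ => (h x).hasDerivWithinAt) hf.continuousOn

lemma hasDerivWithinAt {F f : ℝ → E} (h : IsPrim F f) (hf : ContinuousOn f (Icc 0 1)) {x : ℝ}
    (hx : x ∈ Icc (0 : ℝ) 1) : HasDerivWithinAt F (f x) (Icc 0 1) x := by
  have h0 : (0 : ℝ) ∈ Icc (0 : ℝ) 1 := by simp
  have : Fact (x ∈ Icc (0 : ℝ) 1) := ⟨hx⟩
  have := intervalIntegral.integral_hasDerivWithinAt_of_tendsto_ae_right
    (intervalIntegrable_sub h.int h0 hx) (s := Icc 0 1) (t := Icc 0 1)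
    (hf.stronglyMeasurableAtFilter_nhdsWithin measurableSet_Icc x)
    (((hf x hx).mono_left inf_le_left))
  exact (this.const_add (F 0)).congr h.eq (h.eq x hx)

lemma reflect {F f : ℝ → E} (h : IsPrim F f) :
    IsPrim (fun x => F (1 - x)) (fun x => -f (1 - x)) := by
  have hi : IntervalIntegrable (fun x => f (1 - x)) volume 0 1 := by
    simpa using (h.int.comp_sub_left 1).symm
  refine ⟨hi.neg, fun x hx => ?_⟩
  have h1 : (1 : ℝ) ∈ Icc (0 : ℝ) 1 := by simp
  have hx' : 1 - x ∈ Icc (0 : ℝ) 1 := ⟨by linarith [hx.2], by linarith [hx.1]⟩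
  rw [intervalIntegral.integral_neg, intervalIntegral.integral_comp_sub_left]
  have := h.sub_eq hx' h1
  simp only [sub_zero]
  rw [← this]
  abel

end IsPrim

/-- A function whose increments are controlled by an integral and whose derivative vanishes almost
everywhere is constant. -/
lemma eq_of_ae_hasDerivAt_zero {H : ℝ → E} {b : ℝ → ℝ} (hb : IntervalIntegrable b volume 0 1)
    (hH : ∀ x ∈ Icc (0 : ℝ) 1, ∀ y ∈ Icc (0 : ℝ) 1, ‖H y - H x‖ ≤ |∫ t in x..y, b t|)
    (h0 : ∀ᵐ x, x ∈ Icc (0 : ℝ) 1 → HasDerivAt H 0 x) {x : ℝ} (hx : x ∈ Icc (0 : ℝ) 1) :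
    H x = H 0 := by
  have hac := hb.absolutelyContinuousOnInterval_intervalIntegral (c := 0) (by simp)
  have hI : uIcc (0 : ℝ) 1 = Icc 0 1 := uIcc_of_le zero_le_one
  have z0 : (0 : ℝ) ∈ Icc (0 : ℝ) 1 := by simp
  -- The increments of `H` are dominated by those of the primitive of `b`, so absolute continuity is
  -- inherited.
  have hac' : AbsolutelyContinuousOnInterval H 0 1 := by
    rw [absolutelyContinuousOnInterval_iff] at hac ⊢
    intro ε hε
    obtain ⟨δ, hδ, h⟩ := hac ε hε
    refine ⟨δ, hδ, fun E hE hs => lt_of_le_of_lt ?_ (h E hE hs)⟩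
    refine Finset.sum_le_sum fun i hi => ?_
    have hm := hE.1 i hi
    rw [hI] at hm
    rw [dist_comm, dist_eq_norm, dist_comm, Real.dist_eq,
      intervalIntegral.integral_interval_sub_left (intervalIntegrable_sub hb z0 hm.2)
      (intervalIntegrable_sub hb z0 hm.1)]
    exact hH _ hm.1 _ hm.2
  obtain ⟨C, hC⟩ := hac'.const_of_ae_hasDerivAt_zero (by rwa [hI])
  rw [hI] at hC
  rw [hC x hx, hC 0 z0]

end Primitive

/-! ### The product rule for absolutely continuous functions -/

section Algebra

variable {A : Type*} [NormedRing A] [NormedAlgebra ℝ A] [CompleteSpace A]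

lemma IsPrim.norm_sub_le_integral {F f : ℝ → A} (h : IsPrim F f) {x y : ℝ} (hx : x ∈ Icc (0 : ℝ) 1)
    (hy : y ∈ Icc (0 : ℝ) 1) : ‖F y - F x‖ ≤ |∫ t in x..y, ‖f t‖| := by
  rw [h.sub_eq hx hy]
  exact intervalIntegral.norm_integral_le_abs_integral_norm

lemma intervalIntegrable_mul {f G : ℝ → A} (hf : IntervalIntegrable f volume 0 1)
    (hG : ContinuousOn G (Icc 0 1)) : IntervalIntegrable (fun t => f t * G t) volume 0 1 :=
  hf.mul_continuousOn (by rwa [uIcc_of_le zero_le_one])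

lemma intervalIntegrable_mul' {f G : ℝ → A} (hf : IntervalIntegrable f volume 0 1)
    (hG : ContinuousOn G (Icc 0 1)) : IntervalIntegrable (fun t => G t * f t) volume 0 1 :=
  hf.continuousOn_mul (by rwa [uIcc_of_le zero_le_one])

/-- The difference `H` of the two sides has zero derivative at almost every point, by Lebesgue
differentiation, and its increments are bounded by an integral; hence it is constant. -/
lemma IsPrim.mul {F f G g : ℝ → A} (hF : IsPrim F f) (hG : IsPrim G g) :
    IsPrim (fun x => F x * G x) (fun x => f x * G x + F x * g x) := by
  have z0 : (0 : ℝ) ∈ Icc (0 : ℝ) 1 := by simp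
  have hi := (intervalIntegrable_mul hF.int hG.continuousOn).add
    (intervalIntegrable_mul' hG.int hF.continuousOn)
  refine ⟨hi, fun x hx => ?_⟩
  set H : ℝ → A := fun x => F x * G x - ∫ t in (0 : ℝ)..x, (f t * G t + F t * g t) with hH
  obtain ⟨CF, hCF⟩ := isCompact_Icc.exists_bound_of_continuousOn hF.continuousOn
  obtain ⟨CG, hCG⟩ := isCompact_Icc.exists_bound_of_continuousOn hG.continuousOn
  have hCF0 : 0 ≤ CF := (norm_nonneg _).trans (hCF 0 z0)
  have hCG0 : 0 ≤ CG := (norm_nonneg _).trans (hCG 0 z0)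
  -- The factor 2 counts the increment of `F G` once and that of the integral once.
  have hb : IntervalIntegrable (fun t => 2 * (CG * ‖f t‖ + CF * ‖g t‖)) volume 0 1 :=
    ((hF.int.norm.const_mul _).add (hG.int.norm.const_mul _)).const_mul _
  have hconst : H x = H 0 := by
    refine eq_of_ae_hasDerivAt_zero hb ?_ ?_ hx
    · intro x hx y hy
      have e1 : H y - H x = (F y - F x) * G y + F x * (G y - G x)
          - ∫ t in x..y, (f t * G t + F t * g t) := by
        rw [← intervalIntegral.integral_interval_sub_left (intervalIntegrable_sub hi z0 hy)
          (intervalIntegrable_sub hi z0 hx)]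
        simp only [hH, sub_mul, mul_sub]
        abel
      have hfi := (intervalIntegrable_sub hF.int hx hy).norm
      have hgi := (intervalIntegrable_sub hG.int hx hy).norm
      have e2 : |∫ t in x..y, 2 * (CG * ‖f t‖ + CF * ‖g t‖)| =
          2 * (CG * |∫ t in x..y, ‖f t‖| + CF * |∫ t in x..y, ‖g t‖|) := by
        rw [intervalIntegral.integral_const_mul, intervalIntegral.integral_add
          (hfi.const_mul _) (hgi.const_mul _), intervalIntegral.integral_const_mul,
          intervalIntegral.integral_const_mul]
        rcases le_total x y with h | h
        · rw [abs_of_nonneg (intervalIntegral.integral_nonneg h fun _ _ => norm_nonneg _),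
            abs_of_nonneg (intervalIntegral.integral_nonneg h fun _ _ => norm_nonneg _),
            abs_of_nonneg]
          have := intervalIntegral.integral_nonneg h (μ := volume) fun t _ => norm_nonneg (f t)
          have := intervalIntegral.integral_nonneg h (μ := volume) fun t _ => norm_nonneg (g t)
          positivity
        · rw [intervalIntegral.integral_symm y x, intervalIntegral.integral_symm y x, abs_neg,
            abs_neg]
          have h1 := intervalIntegral.integral_nonneg h (μ := volume) fun t _ => norm_nonneg (f t)
          have h2 := intervalIntegral.integral_nonneg h (μ := volume) fun t _ => norm_nonneg (g t)
          rw [abs_of_nonneg h1, abs_of_nonneg h2, abs_of_nonpos]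
          · ring
          · nlinarith [mul_nonneg hCG0 h1, mul_nonneg hCF0 h2]
      have e3 : ‖∫ t in x..y, (f t * G t + F t * g t)‖ ≤
          CG * |∫ t in x..y, ‖f t‖| + CF * |∫ t in x..y, ‖g t‖| := by
        have hsub : uIoc x y ⊆ Icc (0 : ℝ) 1 := uIoc_subset_uIcc.trans (uIcc_subset_Icc hx hy)
        have : ‖∫ t in x..y, (f t * G t + F t * g t)‖ ≤
            |∫ t in x..y, (CG * ‖f t‖ + CF * ‖g t‖)| := by
          refine intervalIntegral.norm_integral_le_abs_of_norm_le
            ((ae_restrict_iff' measurableSet_uIoc).2 (Eventually.of_forall fun t ht => ?_))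
            ((hfi.const_mul _).add (hgi.const_mul _))
          refine (norm_add_le _ _).trans (add_le_add ?_ ?_)
          · refine (norm_mul_le _ _).trans ?_
            rw [mul_comm]
            exact mul_le_mul_of_nonneg_right (hCG t (hsub ht)) (norm_nonneg _)
          · refine (norm_mul_le _ _).trans ?_
            exact mul_le_mul_of_nonneg_right (hCF t (hsub ht)) (norm_nonneg _)
        refine this.trans (le_of_eq ?_)
        rw [intervalIntegral.integral_const_mul, abs_mul, abs_two] at e2
        linarith
      rw [e1, e2]
      have h1 := hF.norm_sub_le_integral hx hy
      have h2 := hG.norm_sub_le_integral hx hy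
      calc _ ≤ ‖(F y - F x) * G y‖ + ‖F x * (G y - G x)‖ + _ :=
            (_root_.norm_sub_le _ _).trans (add_le_add_left (norm_add_le _ _) _)
        _ ≤ CG * |∫ t in x..y, ‖f t‖| + CF * |∫ t in x..y, ‖g t‖| +
            (CG * |∫ t in x..y, ‖f t‖| + CF * |∫ t in x..y, ‖g t‖|) := by
            refine add_le_add (add_le_add ?_ ?_) e3
            · refine (norm_mul_le _ _).trans ?_
              rw [mul_comm]
              exact mul_le_mul (hCG y hy) h1 (norm_nonneg _) hCG0
            · exact (norm_mul_le _ _).trans (mul_le_mul (hCF x hx) h2 (norm_nonneg _) hCF0)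
        _ = _ := by ring
    · have hF' := hF.int.ae_hasDerivAt_integral
      have hG' := hG.int.ae_hasDerivAt_integral
      have hi' := hi.ae_hasDerivAt_integral
      have hne : ∀ᵐ t : ℝ, t ∉ ({0, 1} : Set ℝ) :=
        measure_eq_zero_iff_ae_notMem.1 ((Set.toFinite _).measure_zero _)
      filter_upwards [hF', hG', hi', hne] with t h1 h2 h3 h4 ht
      have ht' : t ∈ uIcc (0 : ℝ) 1 := by rwa [uIcc_of_le zero_le_one]
      have hnhds : Icc (0 : ℝ) 1 ∈ 𝓝 t := by
        refine Icc_mem_nhds (lt_of_le_of_ne ht.1 ?_) (lt_of_le_of_ne ht.2 ?_)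
        · rintro rfl; simp at h4
        · rintro rfl; simp at h4
      have z0' : (0 : ℝ) ∈ uIcc (0 : ℝ) 1 := by simp
      have d1 : HasDerivAt F (f t) t := ((h1 ht' 0 z0').const_add (F 0)).congr_of_eventuallyEq
        (Filter.eventually_of_mem hnhds hF.eq)
      have d2 : HasDerivAt G (g t) t := ((h2 ht' 0 z0').const_add (G 0)).congr_of_eventuallyEq
        (Filter.eventually_of_mem hnhds hG.eq)
      have := (d1.mul d2).sub (h3 ht' 0 z0')
      rw [sub_self] at this
      exact this
  have : F x * G x = H x + ∫ t in (0 : ℝ)..x, (f t * G t + F t * g t) := by simp [hH]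
  rw [this, hconst]
  simp [hH]

end Algebra

/-! ### Inverses of `1 - T`, and their dependence on the parameter -/

section NormedAlgebra

/-- `1 - T` is a factor of `1 - T ^ n`, the cofactor being a geometric sum that commutes with it. -/
lemma isUnit_one_sub_of_isUnit_one_sub_pow {R : Type*} [Ring R] {T : R} {n : ℕ}
    (h : IsUnit (1 - T ^ n)) : IsUnit (1 - T) := by
  have hcomm : Commute (1 - T) (∑ i ∈ Finset.range n, T ^ i) := by
    refine Commute.sum_right _ _ _ fun i _ => ?_
    exact (Commute.one_left _).sub_left (Commute.refl T |>.pow_right i)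
  rw [← mul_neg_geom_sum] at h
  exact (hcomm.isUnit_mul_iff.1 h).1

lemma differentiable_sub_smul {R : Type*} [NormedRing R] [NormedAlgebra ℂ R] (B J : R) :
    Differentiable ℂ (fun lam : ℂ => B - lam • J) := by
  fun_prop

lemma differentiable_inverse_one_sub {R : Type*} [NormedRing R] [NormedAlgebra ℂ R]
    [CompleteSpace R] (B J : R) (h : ∀ lam : ℂ, IsUnit (1 - J * (B - lam • J))) :
    Differentiable ℂ (fun lam : ℂ => Ring.inverse (1 - J * (B - lam • J))) :=
  Differentiable.inverse (by fun_prop) h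

end NormedAlgebra

/-! ### Volterra operators on `C([0,1], A)` -/

section Volterra

variable {A : Type*} [NormedRing A] [NormedAlgebra ℂ A] [CompleteSpace A]

/-- The extension of a continuous function on `[0,1]` to the real line by constants. -/
abbrev extend (f : C(Icc (0 : ℝ) 1, A)) : ℝ → A := IccExtend (zero_le_one' ℝ) f

lemma continuous_extend (f : C(Icc (0 : ℝ) 1, A)) : Continuous (extend f) :=
  f.continuous.Icc_extend'

lemma norm_extend_le (f : C(Icc (0 : ℝ) 1, A)) (t : ℝ) : ‖extend f t‖ ≤ ‖f‖ :=
  f.norm_coe_le_norm _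

lemma extend_coe (f : C(Icc (0 : ℝ) 1, A)) (t : Icc (0 : ℝ) 1) : extend f t = f t :=
  IccExtend_val _ _ _

lemma extend_zero (f : C(Icc (0 : ℝ) 1, A)) :
    extend f 0 = f ⟨0, unitInterval.zero_mem⟩ :=
  extend_coe f ⟨0, unitInterval.zero_mem⟩

/-- Bounded operators on `C([0,1], A)`. -/
abbrev Ops (A : Type*) [NormedRing A] [NormedAlgebra ℂ A] : Type _ :=
  C(Icc (0 : ℝ) 1, A) →L[ℂ] C(Icc (0 : ℝ) 1, A)

/-- The function `∫₀ˣ q f` in `C([0,1])`. -/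
def volterraFun (q : ℝ → A) (hq : IntervalIntegrable q volume 0 1) (f : C(Icc (0 : ℝ) 1, A)) :
    C(Icc (0 : ℝ) 1, A) :=
  ⟨fun x => ∫ t in (0 : ℝ)..x, q t * extend f t, by
    have := (IsPrim.integral 0 (intervalIntegrable_mul hq
      (continuous_extend f).continuousOn)).continuousOn
    simp only [zero_add] at this
    exact continuousOn_iff_continuous_domRestrict.1 this⟩

lemma volterraFun_apply (q : ℝ → A) (hq : IntervalIntegrable q volume 0 1)
    (f : C(Icc (0 : ℝ) 1, A)) (x : Icc (0 : ℝ) 1) :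
    volterraFun q hq f x = ∫ t in (0 : ℝ)..x, q t * extend f t := rfl

/-- The operator `f ↦ ∫₀ˣ q f` on `C([0,1])`. -/
def volterra (q : ℝ → A) (hq : IntervalIntegrable q volume 0 1) : Ops A :=
  LinearMap.mkContinuous
    { toFun := volterraFun q hq
      map_add' := fun f g => by
        ext x
        have hx : (x : ℝ) ∈ Icc (0 : ℝ) 1 := x.2
        rw [ContinuousMap.add_apply, volterraFun_apply, volterraFun_apply, volterraFun_apply,
          ← intervalIntegral.integral_add]
        · simp [IccExtend, mul_add]
        all_goals exact intervalIntegrable_sub (intervalIntegrable_mul hq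
          (continuous_extend _).continuousOn) (by simp) hx
      map_smul' := fun c f => by
        ext x
        rw [ContinuousMap.smul_apply, volterraFun_apply, volterraFun_apply, RingHom.id_apply,
          ← intervalIntegral.integral_smul]
        simp [IccExtend] }
    (∫ t in (0 : ℝ)..1, ‖q t‖) (fun f => by
      refine (ContinuousMap.norm_le _ (mul_nonneg (intervalIntegral.integral_nonneg zero_le_one
        fun _ _ => norm_nonneg _) (norm_nonneg _))).2 fun x => ?_
      have hx01 : (x : ℝ) ∈ Icc (0 : ℝ) 1 := x.2
      have hx := intervalIntegrable_sub hq.norm unitInterval.zero_mem hx01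
      have h1 : ‖∫ t in (0 : ℝ)..x, q t * extend f t‖ ≤ ∫ t in (0 : ℝ)..x, ‖q t‖ * ‖f‖ :=
        intervalIntegral.norm_integral_le_of_norm_le x.2.1
          (Eventually.of_forall fun t _ => (norm_mul_le _ _).trans
            (mul_le_mul_of_nonneg_left (norm_extend_le f t) (norm_nonneg _))) (hx.mul_const _)
      refine h1.trans ?_
      rw [intervalIntegral.integral_mul_const]
      refine mul_le_mul_of_nonneg_right ?_ (norm_nonneg _)
      exact intervalIntegral.integral_mono_interval le_rfl x.2.1 x.2.2
        (Eventually.of_forall fun _ => norm_nonneg _) hq.norm)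

lemma volterra_apply (q : ℝ → A) (hq : IntervalIntegrable q volume 0 1)
    (f : C(Icc (0 : ℝ) 1, A)) (x : Icc (0 : ℝ) 1) :
    volterra q hq f x = ∫ t in (0 : ℝ)..x, q t * extend f t := rfl

lemma isPrim_extend_volterra (q : ℝ → A) (hq : IntervalIntegrable q volume 0 1)
    (f : C(Icc (0 : ℝ) 1, A)) :
    IsPrim (extend (volterra q hq f)) (fun t => q t * extend f t) := by
  refine (IsPrim.integral 0 (intervalIntegrable_mul hq
    (continuous_extend f).continuousOn)).congr (fun x hx => ?_) fun _ _ => rfl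
  rw [show extend (volterra q hq f) x = volterra q hq f ⟨x, hx⟩ from
    extend_coe (volterra q hq f) ⟨x, hx⟩, volterra_apply, zero_add]

/-- Integration `f ↦ ∫₀ˣ f` on `C([0,1])`. -/
def integration : Ops A :=
  volterra (fun _ => 1) (by simp)

lemma isPrim_extend_integration (f : C(Icc (0 : ℝ) 1, A)) :
    IsPrim (extend (integration f)) (extend f) :=
  (isPrim_extend_volterra _ _ f).congr (fun _ _ => rfl) fun _ _ => one_mul _

/-- A bound `c tⁿ` is monotone in `t`, so integration against `q` costs only the factor `∫ ‖q‖`. The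
plain integration that follows raises the power of `x` and divides by `n + 1`; this is the source of
the factorial. -/
lemma norm_integration_volterra_pow_le (q : ℝ → A) (hq : IntervalIntegrable q volume 0 1) (n : ℕ)
    (f : C(Icc (0 : ℝ) 1, A)) (x : Icc (0 : ℝ) 1) :
    ‖((integration * volterra q hq : Ops A) ^ n) f x‖ ≤
      (∫ t in (0 : ℝ)..1, ‖q t‖) ^ n * (x : ℝ) ^ n / n.factorial * ‖f‖ := by
  set Q := ∫ t in (0 : ℝ)..1, ‖q t‖ with hQ
  have hQ0 : 0 ≤ Q := intervalIntegral.integral_nonneg zero_le_one fun _ _ => norm_nonneg _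
  induction n generalizing x with
  | zero => simpa using f.norm_coe_le_norm x
  | succ n ih =>
    rw [pow_succ', mul_apply_eq_comp]
    set h := ((integration * volterra q hq : Ops A) ^ n) f with hh
    set c := Q ^ n / n.factorial * ‖f‖ with hc
    have hc0 : 0 ≤ c := by positivity
    have ih' : ∀ y : Icc (0 : ℝ) 1, ‖h y‖ ≤ c * (y : ℝ) ^ n := fun y =>
      (ih y).trans (le_of_eq (by rw [hc]; ring))
    have h1 : ∀ y : Icc (0 : ℝ) 1, ‖volterra q hq h y‖ ≤ Q * (c * (y : ℝ) ^ n) := by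
      intro y
      rw [volterra_apply]
      have hy := intervalIntegrable_sub hq.norm unitInterval.zero_mem (show (y : ℝ) ∈ Icc (0 : ℝ) 1 from y.2)
      have e1 : ‖∫ t in (0 : ℝ)..y, q t * extend h t‖ ≤
          ∫ t in (0 : ℝ)..y, ‖q t‖ * (c * (y : ℝ) ^ n) := by
        refine intervalIntegral.norm_integral_le_of_norm_le y.2.1
          (Eventually.of_forall fun t ht => (norm_mul_le _ _).trans
            (mul_le_mul_of_nonneg_left ?_ (norm_nonneg _))) (hy.mul_const _)
        have ht' : t ∈ Icc (0 : ℝ) 1 := ⟨ht.1.le, ht.2.trans y.2.2⟩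
        rw [show extend h t = h ⟨t, ht'⟩ from extend_coe h ⟨t, ht'⟩]
        refine (ih' _).trans (mul_le_mul_of_nonneg_left ?_ hc0)
        exact pow_le_pow_left₀ ht.1.le ht.2 n
      refine e1.trans ?_
      rw [intervalIntegral.integral_mul_const]
      refine mul_le_mul_of_nonneg_right ?_ (mul_nonneg hc0 (pow_nonneg y.2.1 n))
      exact intervalIntegral.integral_mono_interval le_rfl y.2.1 y.2.2
        (Eventually.of_forall fun _ => norm_nonneg _) hq.norm
    have e2 : ‖integration (volterra q hq h) x‖ ≤
        ∫ t in (0 : ℝ)..x, Q * (c * t ^ n) := by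
      rw [integration, volterra_apply]
      refine intervalIntegral.norm_integral_le_of_norm_le x.2.1
        (Eventually.of_forall fun t ht => ?_) (Continuous.intervalIntegrable (by fun_prop) _ _)
      have ht' : t ∈ Icc (0 : ℝ) 1 := ⟨ht.1.le, ht.2.trans x.2.2⟩
      rw [one_mul, show extend (volterra q hq h) t = volterra q hq h ⟨t, ht'⟩ from
        extend_coe (volterra q hq h) ⟨t, ht'⟩]
      exact h1 ⟨t, ht'⟩
    rw [mul_apply_eq_comp]
    refine e2.trans (le_of_eq ?_)
    rw [intervalIntegral.integral_const_mul, intervalIntegral.integral_const_mul, integral_pow,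
      hc, Nat.factorial_succ]
    have : (n.factorial : ℝ) ≠ 0 := by positivity
    push_cast
    field_simp
    ring

/-- The factorial decay makes some power of the operator a strict contraction, whatever the size of
`q`. -/
lemma isUnit_one_sub_integration_volterra (q : ℝ → A) (hq : IntervalIntegrable q volume 0 1) :
    IsUnit (1 - (integration * volterra q hq : Ops A)) := by
  set T := (integration * volterra q hq : Ops A)
  set Q := ∫ t in (0 : ℝ)..1, ‖q t‖ with hQ
  have hQ0 : 0 ≤ Q := intervalIntegral.integral_nonneg zero_le_one fun _ _ => norm_nonneg _
  obtain ⟨n, hn⟩ := ((FloorSemiring.tendsto_pow_div_factorial_atTop Q).eventually_lt_const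
    one_pos).exists
  have hT : ‖T ^ n‖ < 1 := by
    refine lt_of_le_of_lt (ContinuousLinearMap.opNorm_le_bound _ (by positivity) fun f => ?_) hn
    refine (ContinuousMap.norm_le _ (by positivity)).2 fun x => ?_
    refine (norm_integration_volterra_pow_le q hq n f x).trans ?_
    refine mul_le_mul_of_nonneg_right ?_ (norm_nonneg _)
    refine div_le_div_of_nonneg_right ?_ (by positivity)
    exact mul_le_of_le_one_right (by positivity) (pow_le_one₀ x.2.1 x.2.2)
  have hu : IsUnit (1 - T ^ n) := isUnit_one_sub_of_norm_lt_one (R := Ops A) hT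
  exact isUnit_one_sub_of_isUnit_one_sub_pow (R := Ops A) hu

/-- The operator `f ↦ ∫₀ˣ (V - lam) f`. -/
def dstepOp (V : ℝ → A) (hV : IntervalIntegrable V volume 0 1) (lam : ℂ) : Ops A :=
  volterra V hV - lam • integration

/-- The operator `f ↦ ∫₀ˣ ∫₀ᵗ (V - lam) f`. -/
def stepOp (V : ℝ → A) (hV : IntervalIntegrable V volume 0 1) (lam : ℂ) : Ops A :=
  integration * dstepOp V hV lam

/-- Links two descriptions of one operator: the left side is covered by the Volterra estimate, the
right side is visibly affine in `lam`, hence analytic. -/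
lemma volterra_sub_smul (V : ℝ → A) (hV : IntervalIntegrable V volume 0 1) (lam : ℂ)
    (h : IntervalIntegrable (fun t => V t - lam • (1 : A)) volume 0 1) :
    volterra (fun t => V t - lam • (1 : A)) h = dstepOp V hV lam := by
  ext f x
  simp only [dstepOp, sub_apply, smul_apply, integration,
    ContinuousMap.sub_apply, ContinuousMap.smul_apply, volterra_apply]
  have hx : (x : ℝ) ∈ Icc (0 : ℝ) 1 := x.2
  rw [← intervalIntegral.integral_smul, ← intervalIntegral.integral_sub]
  · simp [sub_mul]
  · exact intervalIntegrable_sub (intervalIntegrable_mul hV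
      (continuous_extend _).continuousOn) (by simp) hx
  · exact Continuous.intervalIntegrable (by have := continuous_extend f; fun_prop) _ _

end Volterra

/-! ### The initial value problem: existence, uniqueness, analyticity in `lam` -/

section Solutions

variable {A : Type*} [NormedRing A] [NormedAlgebra ℂ A] [CompleteSpace A]

/-- `Y` solves `-Y'' + V Y = lam Y` on `[0,1]`, with derivative `Y'`, in the algebra `A`. -/
structure Sol (V : ℝ → A) (lam : ℂ) (Y Y' : ℝ → A) : Prop where
  prim : IsPrim Y Y'
  prim' : IsPrim Y' (fun t => V t * Y t - lam • Y t)

/-- The affine function `a + x b`. -/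
def affine (a b : A) : C(Icc (0 : ℝ) 1, A) := ⟨fun x => a + ((x : ℝ) : ℂ) • b, by fun_prop⟩

/-- The solution with `Y 0 = a`, `Y' 0 = b`, as an element of `C([0,1])`. -/
def solC (V : ℝ → A) (hV : IntervalIntegrable V volume 0 1) (a b : A) (lam : ℂ) :
    C(Icc (0 : ℝ) 1, A) :=
  Ring.inverse (1 - stepOp V hV lam) (affine a b)

/-- The derivative of the solution with `Y 0 = a`, `Y' 0 = b`, as an element of `C([0,1])`. -/
def dsolC (V : ℝ → A) (hV : IntervalIntegrable V volume 0 1) (a b : A) (lam : ℂ) :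
    C(Icc (0 : ℝ) 1, A) :=
  ContinuousMap.const _ b + (dstepOp V hV lam) (solC V hV a b lam)

variable {V : ℝ → A} (hV : IntervalIntegrable V volume 0 1) (a b : A)

lemma isUnit_one_sub_mul (lam : ℂ) :
    IsUnit (1 - stepOp V hV lam) := by
  rw [stepOp, ← volterra_sub_smul V hV lam (hV.sub (by simp))]
  exact isUnit_one_sub_integration_volterra _ _

lemma differentiable_dstepOp : Differentiable ℂ (dstepOp V hV) :=
  differentiable_sub_smul (R := Ops A) (volterra V hV) integration

/-- Inversion is analytic on units and the operator is affine in `lam`. Working in `C([0,1])` gives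
analyticity in the sup norm, so evaluations and integrals of solutions are analytic as well. -/
lemma differentiable_solC : Differentiable ℂ (solC V hV a b) := by
  have h2 : Differentiable ℂ (fun lam : ℂ => Ring.inverse (1 - stepOp V hV lam)) :=
    differentiable_inverse_one_sub (R := Ops A) (volterra V hV) integration
      fun lam => isUnit_one_sub_mul hV lam
  exact h2.clm_apply (differentiable_const _)

lemma differentiable_dsolC : Differentiable ℂ (dsolC V hV a b) :=
  (differentiable_const _).add ((differentiable_dstepOp hV).clm_apply (differentiable_solC hV a b))

lemma solC_eq (lam : ℂ) : solC V hV a b lam = affine a b + integration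
    ((dstepOp V hV lam) (solC V hV a b lam)) := by
  have h := Ring.mul_inverse_cancel _ (isUnit_one_sub_mul hV lam)
  have h2 := congrArg (fun T => T (affine a b)) h
  simp only [mul_apply_eq_comp, one_apply_eq_self,
    sub_apply] at h2
  exact sub_eq_iff_eq_add.1 h2

/-- The solution with `Y 0 = a`, `Y' 0 = b`. -/
def sol (V : ℝ → A) (hV : IntervalIntegrable V volume 0 1) (a b : A) (lam : ℂ) (x : ℝ) : A :=
  extend (solC V hV a b lam) x

/-- The derivative of `sol`. -/
def dsol (V : ℝ → A) (hV : IntervalIntegrable V volume 0 1) (a b : A) (lam : ℂ) (x : ℝ) : A :=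
  extend (dsolC V hV a b lam) x

lemma continuous_sol (lam : ℂ) : Continuous (sol V hV a b lam) := continuous_extend _

lemma differentiable_sol (x : ℝ) : Differentiable ℂ (fun lam => sol V hV a b lam x) :=
  (ContinuousMap.evalCLM ℂ (projIcc 0 1 (zero_le_one' ℝ) x) :
    C(Icc (0 : ℝ) 1, A) →L[ℂ] A).differentiable.comp (differentiable_solC hV a b)

lemma differentiable_dsol (x : ℝ) : Differentiable ℂ (fun lam => dsol V hV a b lam x) :=
  (ContinuousMap.evalCLM ℂ (projIcc 0 1 (zero_le_one' ℝ) x) :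
    C(Icc (0 : ℝ) 1, A) →L[ℂ] A).differentiable.comp (differentiable_dsolC hV a b)

lemma extend_add (f g : C(Icc (0 : ℝ) 1, A)) (x : ℝ) :
    extend (f + g) x = extend f x + extend g x := rfl

lemma sol_isSol (lam : ℂ) : Sol V lam (sol V hV a b lam) (dsol V hV a b lam) := by
  constructor
  · have haff : IsPrim (extend (affine a b)) (fun _ => b) := by
      have := (IsPrim.of_hasDerivAt (F := fun x : ℝ => a + (x : ℂ) • b) (f := fun _ => b)
        (fun x => by simpa using ((Complex.ofRealCLM.hasDerivAt (x := x)).smul_const b).const_add a)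
        continuous_const)
      exact this.congr (fun x hx => (extend_coe (affine a b) ⟨x, hx⟩).symm) fun _ _ => rfl
    refine (haff.add (isPrim_extend_integration
      ((dstepOp V hV lam) (solC V hV a b lam)))).congr (fun x hx => ?_) ?_
    · rw [sol, ← extend_add, ← solC_eq hV a b lam]
    · intro x _
      simp [dsol, dsolC, extend_add, IccExtend]
  · have h := ((IsPrim.const b).add (isPrim_extend_volterra (fun t => V t - lam • (1 : A))
      (hV.sub (by simp)) (solC V hV a b lam)))
    refine h.congr (fun x _ => ?_) fun x _ => ?_
    · rw [volterra_sub_smul V hV lam]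
      rfl
    · simp [sol, sub_mul]

lemma sol_zero (lam : ℂ) : sol V hV a b lam 0 = a := by
  rw [sol, solC_eq, extend_add, extend_zero, extend_zero]
  simp [integration, volterra_apply, affine]

lemma dsol_zero (lam : ℂ) : dsol V hV a b lam 0 = b := by
  rw [dsol, dsolC, extend_add, extend_zero, extend_zero,
    ← volterra_sub_smul V hV lam (hV.sub (by simp))]
  simp [volterra_apply]

variable {a b}

/-- Integrating the equation twice shows that any solution satisfies the same fixed point equation,
whose operator `1 - stepOp` is invertible. -/
lemma Sol.eq_sol {lam : ℂ} {Y Y' : ℝ → A} (h : Sol V lam Y Y') {x : ℝ}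
    (hx : x ∈ Icc (0 : ℝ) 1) : Y x = sol V hV (Y 0) (Y' 0) lam x := by
  set f : C(Icc (0 : ℝ) 1, A) := ⟨fun x => Y x,
    continuousOn_iff_continuous_domRestrict.1 h.prim.continuousOn⟩ with hf
  have hfe : ∀ x ∈ Icc (0 : ℝ) 1, extend f x = Y x := fun x hx => extend_coe f ⟨x, hx⟩
  have key : (1 - stepOp V hV lam) f =
      affine (Y 0) (Y' 0) := by
    ext x
    have hx : (x : ℝ) ∈ Icc (0 : ℝ) 1 := x.2
    have e : ∀ t ∈ Icc (0 : ℝ) 1,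
        extend ((dstepOp V hV lam) f) t = Y' t - Y' 0 := by
      intro t ht
      rw [← volterra_sub_smul V hV lam (hV.sub (by simp))]
      rw [show extend (volterra (fun t => V t - lam • (1 : A)) (hV.sub (by simp)) f) t = _ from
        extend_coe _ ⟨t, ht⟩, volterra_apply, h.prim'.eq t ht, add_sub_cancel_left]
      refine intervalIntegral.integral_congr fun s hs => ?_
      rw [uIcc_of_le ht.1] at hs
      rw [hfe s ⟨hs.1, hs.2.trans ht.2⟩]
      simp [sub_mul]
    simp only [sub_apply,
      one_apply_eq_self, stepOp, mul_apply_eq_comp, ContinuousMap.sub_apply]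
    rw [← extend_coe (integration _) x, (isPrim_extend_integration _).eq x hx,
      show extend (integration ((dstepOp V hV lam) f)) 0 = 0 by
        rw [extend_zero]
        simp [integration, volterra_apply], zero_add,
      intervalIntegral.integral_congr (g := fun t => Y' t - Y' 0) (fun t ht => by
        rw [uIcc_of_le hx.1] at ht
        exact e t ⟨ht.1, ht.2.trans hx.2⟩),
      intervalIntegral.integral_sub (intervalIntegrable_sub h.prim.int (by simp) hx) (by simp)]
    rw [intervalIntegral.integral_const, sub_zero, ← extend_coe f x, hfe x hx, h.prim.eq x hx]
    simp only [affine, ContinuousMap.coe_mk]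
    rw [Complex.coe_smul]
    abel
  have : f = solC V hV (Y 0) (Y' 0) lam := by
    rw [solC, ← key, ← mul_apply_eq_comp,
      Ring.inverse_mul_cancel _ (isUnit_one_sub_mul hV lam)]
    rfl
  rw [sol, ← this, hfe x hx]

lemma Sol.unique {lam : ℂ} {Y Y' Z Z' : ℝ → A} (hV : IntervalIntegrable V volume 0 1)
    (hY : Sol V lam Y Y') (hZ : Sol V lam Z Z')
    (h0 : Y 0 = Z 0) (h1 : Y' 0 = Z' 0) {x : ℝ} (hx : x ∈ Icc (0 : ℝ) 1) :
    Y x = Z x ∧ Y' x = Z' x := by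
  have e : ∀ x ∈ Icc (0 : ℝ) 1, Y x = Z x := fun x hx => by
    rw [hY.eq_sol hV hx, hZ.eq_sol hV hx, h0, h1]
  refine ⟨e x hx, ?_⟩
  rw [hY.prim'.eq x hx, hZ.prim'.eq x hx, h1]
  congr 1
  refine intervalIntegral.integral_congr fun t ht => ?_
  rw [uIcc_of_le hx.1] at ht
  rw [e t ⟨ht.1, ht.2.trans hx.2⟩]

lemma Sol.add {lam : ℂ} {Y Y' Z Z' : ℝ → A} (hY : Sol V lam Y Y') (hZ : Sol V lam Z Z') :
    Sol V lam (fun x => Y x + Z x) (fun x => Y' x + Z' x) :=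
  ⟨hY.prim.add hZ.prim, (hY.prim'.add hZ.prim').congr (fun _ _ => rfl) fun _ _ => by
    simp only [mul_add, smul_add]; abel⟩

lemma IsPrim.mul_const {F f : ℝ → A} (h : IsPrim F f) (m : A) :
    IsPrim (fun x => F x * m) (fun x => f x * m) :=
  (h.mul (IsPrim.const m)).congr (fun _ _ => rfl) fun _ _ => by simp

lemma IsPrim.const_mul {F f : ℝ → A} (h : IsPrim F f) (m : A) :
    IsPrim (fun x => m * F x) (fun x => m * f x) :=
  ((IsPrim.const m).mul h).congr (fun _ _ => rfl) fun _ _ => by simp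

lemma Sol.mul_const {lam : ℂ} {Y Y' : ℝ → A} (hY : Sol V lam Y Y') (m : A) :
    Sol V lam (fun x => Y x * m) (fun x => Y' x * m) :=
  ⟨hY.prim.mul_const m, (hY.prim'.mul_const m).congr (fun _ _ => rfl) fun _ _ => by
    simp [sub_mul, mul_assoc]⟩

/-- Turns conditions at `1` into conditions at `0`, so that the estimates for the sine solution also
serve the Weyl solution. -/
lemma Sol.reflect {lam : ℂ} {Y Y' : ℝ → A} (hY : Sol V lam Y Y') :
    Sol (fun x => V (1 - x)) lam (fun x => Y (1 - x)) (fun x => -Y' (1 - x)) :=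
  ⟨hY.prim.reflect, hY.prim'.reflect.neg.congr (fun _ _ => rfl) fun _ _ => neg_neg _⟩


end Solutions

/-! ### Lagrange identity and Wronskians -/

section Lagrange

variable {A : Type*} [NormedRing A] [NormedAlgebra ℂ A] [CompleteSpace A] [StarRing A]
  [NormedStarGroup A] [StarModule ℂ A]

lemma IsPrim.star {F f : ℝ → A} (h : IsPrim F f) :
    IsPrim (fun x => star (F x)) (fun x => star (f x)) :=
  h.clm ((starL' ℝ : A ≃L[ℝ] A) : A →L[ℝ] A)

/-- The Lagrange identity. -/
lemma Sol.lagrange {V : ℝ → A} (hs : ∀ᵐ x, x ∈ Ioc (0 : ℝ) 1 → star (V x) = V x)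
    {lam mu : ℂ} {Y Y' Z Z' : ℝ → A} (hY : Sol V lam Y Y') (hZ : Sol V mu Z Z') :
    IsPrim (fun x => star (Z x) * Y' x - star (Z' x) * Y x)
      (fun x => (star mu - lam) • (star (Z x) * Y x)) := by
  refine ((hZ.prim.star.mul hY.prim').sub (hZ.prim'.star.mul hY.prim)).congr_ae ?_
  filter_upwards [hs] with x hx hx'
  simp only [star_sub, star_mul, star_smul, hx hx', mul_sub, sub_mul, sub_smul, mul_assoc,
    mul_smul_comm, smul_mul_assoc]
  abel

/-- The Wronskian of solutions for conjugate parameters is constant. -/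
lemma Sol.wronskian_eq {V : ℝ → A} (hs : ∀ᵐ x, x ∈ Ioc (0 : ℝ) 1 → star (V x) = V x)
    {lam mu : ℂ} (hmu : star mu = lam) {Y Y' Z Z' : ℝ → A} (hY : Sol V lam Y Y')
    (hZ : Sol V mu Z Z') {x : ℝ} (hx : x ∈ Icc (0 : ℝ) 1) :
    star (Z x) * Y' x - star (Z' x) * Y x = star (Z 0) * Y' 0 - star (Z' 0) * Y 0 := by
  have := (hY.lagrange hs hZ).eq x hx
  simpa [hmu] using this

end Lagrange

/-! ### Bounds for the sine solution at large `k` -/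

section Asymptotics

variable {A : Type*} [NormedRing A] [NormedAlgebra ℂ A] [CompleteSpace A]

lemma IsPrim.smul {c c' : ℝ → ℂ} {F f : ℝ → A} (hc : ∀ x, HasDerivAt c (c' x) x)
    (hc' : Continuous c') (h : IsPrim F f) :
    IsPrim (fun x => c x • F x) (fun x => c' x • F x + c x • f x) := by
  have h1 : IsPrim (fun x => c x • (1 : A)) (fun x => c' x • (1 : A)) :=
    IsPrim.of_hasDerivAt (fun x => (hc x).smul_const 1) (by fun_prop)
  exact (h1.mul h).congr (fun _ _ => by simp) fun _ _ => by simp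

lemma hasDerivAt_cos_sub (k : ℂ) (x t : ℝ) :
    HasDerivAt (fun t : ℝ => Complex.cos (k * (x - t))) (k * Complex.sin (k * (x - t))) t := by
  have h : HasDerivAt (fun t : ℂ => Complex.cos (k * (x - t)))
      (k * Complex.sin (k * (x - t))) (t : ℂ) := by
    have := ((((hasDerivAt_id (t : ℂ)).const_sub (x : ℂ)).const_mul k)).ccos
    convert! this using 1
    simp
    ring
  exact h.comp_ofReal

lemma hasDerivAt_sin_sub_div {k : ℂ} (hk : k ≠ 0) (x t : ℝ) :
    HasDerivAt (fun t : ℝ => Complex.sin (k * (x - t)) / k) (-Complex.cos (k * (x - t))) t := by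
  have h : HasDerivAt (fun t : ℂ => Complex.sin (k * (x - t)) / k)
      (-Complex.cos (k * (x - t))) (t : ℂ) := by
    have := ((((hasDerivAt_id (t : ℂ)).const_sub (x : ℂ)).const_mul k)).csin.div_const k
    convert! this using 1
    field_simp
    simp
  exact h.comp_ofReal

/-- Variation of constants. -/
lemma Sol.variation {V : ℝ → A} {k : ℂ} (hk : k ≠ 0) {Y Y' : ℝ → A}
    (h : Sol V (k ^ 2) Y Y') (h0 : Y 0 = 0) (h1 : Y' 0 = 1) {x : ℝ} (hx : x ∈ Icc (0 : ℝ) 1) :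
    Y x = (Complex.sin (k * x) / k) • (1 : A) +
      ∫ t in (0 : ℝ)..x, (Complex.sin (k * (x - t)) / k) • (V t * Y t) := by
  have e := ((h.prim.smul (hasDerivAt_cos_sub k x) (by fun_prop)).add
    (h.prim'.smul (hasDerivAt_sin_sub_div hk x) (by fun_prop))).congr (fun _ _ => rfl)
    (g := fun t => (Complex.sin (k * (x - t)) / k) • (V t * Y t)) (fun t _ => by
      simp only [smul_sub, smul_smul, neg_smul]
      rw [show Complex.sin (k * (x - t)) / k * k ^ 2 = k * Complex.sin (k * (x - t)) by
        field_simp]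
      abel)
  simpa [h0, h1] using e.eq x hx

lemma Sol.variation_deriv {V : ℝ → A} {k : ℂ} (hk : k ≠ 0) {Y Y' : ℝ → A}
    (h : Sol V (k ^ 2) Y Y') (h0 : Y 0 = 0) (h1 : Y' 0 = 1) {x : ℝ} (hx : x ∈ Icc (0 : ℝ) 1) :
    Y' x = Complex.cos (k * x) • (1 : A) +
      ∫ t in (0 : ℝ)..x, Complex.cos (k * (x - t)) • (V t * Y t) := by
  -- The function `cos(k(x-t)) Y'(t) - k sin(k(x-t)) Y(t)` has derivative `cos(k(x-t)) V Y`; using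
  -- it avoids differentiating an integral in its upper limit.
  have e := ((h.prim'.smul (hasDerivAt_cos_sub k x) (by fun_prop)).sub
    ((h.prim.smul (c := fun t : ℝ => k ^ 2 * (Complex.sin (k * (x - t)) / k))
      (c' := fun t : ℝ => k ^ 2 * (-Complex.cos (k * (x - t))))
      (fun t => (hasDerivAt_sin_sub_div hk x t).const_mul _) (by fun_prop)))).congr
    (fun _ _ => rfl)
    (g := fun t => Complex.cos (k * (x - t)) • (V t * Y t)) (fun t _ => by
      simp only [smul_sub, smul_smul, neg_smul, mul_neg]
      rw [show k ^ 2 * (Complex.sin (k * (x - t)) / k) = k * Complex.sin (k * (x - t)) by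
        field_simp, mul_comm (Complex.cos _) (k ^ 2)]
      abel)
  simpa [h0, h1] using e.eq x hx

lemma norm_exp_mul_I_le (z : ℂ) : ‖Complex.exp (z * Complex.I)‖ ≤ Real.exp |z.im| := by
  rw [Complex.norm_exp]
  simp only [Complex.mul_re, Complex.I_re, mul_zero, Complex.I_im, mul_one, zero_sub]
  exact Real.exp_le_exp.2 (neg_le_abs _)

lemma norm_cos_le (z : ℂ) : ‖Complex.cos z‖ ≤ Real.exp |z.im| := by
  have h1 := norm_exp_mul_I_le z
  have h2 := norm_exp_mul_I_le (-z)
  rw [Complex.neg_im, abs_neg] at h2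
  rw [Complex.cos, norm_div, Complex.norm_ofNat]
  have := norm_add_le (Complex.exp (z * Complex.I)) (Complex.exp (-z * Complex.I))
  linarith

lemma norm_sin_le (z : ℂ) : ‖Complex.sin z‖ ≤ Real.exp |z.im| := by
  have h1 := norm_exp_mul_I_le z
  have h2 := norm_exp_mul_I_le (-z)
  rw [Complex.neg_im, abs_neg] at h2
  rw [Complex.sin, norm_div, norm_mul, Complex.norm_I, mul_one, Complex.norm_ofNat]
  have := norm_sub_le (Complex.exp (-z * Complex.I)) (Complex.exp (z * Complex.I))
  linarith

lemma abs_im_mul_sub (k : ℂ) {x t : ℝ} (h : t ≤ x) :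
    |(k * ((x : ℂ) - t)).im| = |k.im| * (x - t) := by
  rw [← Complex.ofReal_sub, Complex.im_mul_ofReal, abs_mul, abs_of_nonneg (sub_nonneg.2 h)]

lemma abs_im_mul_ofReal (k : ℂ) {x : ℝ} (h : 0 ≤ x) : |(k * (x : ℂ)).im| = |k.im| * x := by
  rw [Complex.im_mul_ofReal, abs_mul, abs_of_nonneg h]

/-- The weights `exp(τ(x-t))` and `exp(τt)` multiply to `exp(τx)`, independent of `t`, so only `∫
‖V‖` remains. -/
lemma norm_integral_smul_le {V Y : ℝ → A} (hV : IntervalIntegrable V volume 0 1)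
    {c : ℝ → ℂ} {α β τ x Q : ℝ} (hα : 0 ≤ α) (hβ : 0 ≤ β)
    (hQ : ∫ t in (0 : ℝ)..1, ‖V t‖ ≤ Q) (hx : x ∈ Icc (0 : ℝ) 1)
    (hc : ∀ t ∈ Icc (0 : ℝ) x, ‖c t‖ ≤ α * Real.exp (τ * (x - t)))
    (hY : ∀ t ∈ Icc (0 : ℝ) x, ‖Y t‖ ≤ β * Real.exp (τ * t)) :
    ‖∫ t in (0 : ℝ)..x, c t • (V t * Y t)‖ ≤ α * β * Q * Real.exp (τ * x) := by
  have hVx := (intervalIntegrable_sub hV unitInterval.zero_mem hx).norm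
  have h1 : ‖∫ t in (0 : ℝ)..x, c t • (V t * Y t)‖ ≤
      ∫ t in (0 : ℝ)..x, ‖V t‖ * (α * β * Real.exp (τ * x)) := by
    refine intervalIntegral.norm_integral_le_of_norm_le hx.1
      (Eventually.of_forall fun t ht => ?_) (hVx.mul_const _)
    have ht' : t ∈ Icc (0 : ℝ) x := ⟨ht.1.le, ht.2⟩
    rw [norm_smul]
    calc ‖c t‖ * ‖V t * Y t‖ ≤ (α * Real.exp (τ * (x - t))) *
          (‖V t‖ * (β * Real.exp (τ * t))) :=
          mul_le_mul (hc t ht') ((norm_mul_le _ _).trans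
            (mul_le_mul_of_nonneg_left (hY t ht') (norm_nonneg _))) (norm_nonneg _) (by positivity)
      _ = ‖V t‖ * (α * β * (Real.exp (τ * (x - t)) * Real.exp (τ * t))) := by ring
      _ = _ := by rw [← Real.exp_add]; ring_nf
  refine h1.trans ?_
  rw [intervalIntegral.integral_mul_const]
  have h2 : ∫ t in (0 : ℝ)..x, ‖V t‖ ≤ Q :=
    (intervalIntegral.integral_mono_interval le_rfl hx.1 hx.2
      (Eventually.of_forall fun _ => norm_nonneg _) hV.norm).trans hQ
  calc _ ≤ Q * (α * β * Real.exp (τ * x)) :=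
        mul_le_mul_of_nonneg_right h2 (by positivity)
    _ = _ := by ring

variable [NormOneClass A]

section Sine

variable {V : ℝ → A} (hV : IntervalIntegrable V volume 0 1) {Q : ℝ}
  (hQ : ∫ t in (0 : ℝ)..1, ‖V t‖ ≤ Q) {k : ℂ} (hk : k ≠ 0) (hkQ : 2 * Q ≤ ‖k‖)
  {Y Y' : ℝ → A} (h : Sol V (k ^ 2) Y Y') (h0 : Y 0 = 0) (h1 : Y' 0 = 1)

include hV hQ hk hkQ h h0 h1

/-- With `β` the maximum of `‖Y‖ exp(-|Im k| t)`, variation of constants at the maximum point gives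
`β ≤ 1/|k| + β Q/|k|`, and `Q/|k| ≤ 1/2` absorbs the last term. -/
lemma Sol.norm_le {x : ℝ} (hx : x ∈ Icc (0 : ℝ) 1) :
    ‖Y x‖ ≤ 2 / ‖k‖ * Real.exp (|k.im| * x) := by
  have hk' : 0 < ‖k‖ := norm_pos_iff.2 hk
  have hcont : ContinuousOn (fun t => ‖Y t‖ * Real.exp (-(|k.im| * t))) (Icc 0 1) :=
    h.prim.continuousOn.norm.mul (by fun_prop)
  obtain ⟨x0, hx0, hmax⟩ := isCompact_Icc.exists_isMaxOn ⟨0, unitInterval.zero_mem⟩ hcont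
  set β := ‖Y x0‖ * Real.exp (-(|k.im| * x0)) with hβ
  have hβ0 : 0 ≤ β := by positivity
  have hY : ∀ t ∈ Icc (0 : ℝ) 1, ‖Y t‖ ≤ β * Real.exp (|k.im| * t) := by
    intro t ht
    have := hmax ht
    simp only [mem_ofPred_eq, Real.exp_neg] at this
    rw [← div_eq_mul_inv, div_le_iff₀ (Real.exp_pos _)] at this
    rwa [hβ, Real.exp_neg]
  have hb := h.variation hk h0 h1 hx0
  have e1 : ‖(Complex.sin (k * x0) / k) • (1 : A)‖ ≤ 1 / ‖k‖ * Real.exp (|k.im| * x0) := by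
    rw [norm_smul, norm_one, mul_one, norm_div, div_mul_eq_mul_div, one_mul]
    refine div_le_div_of_nonneg_right ?_ hk'.le
    rw [← abs_im_mul_ofReal k hx0.1]
    exact norm_sin_le _
  have e2 := norm_integral_smul_le (c := fun t : ℝ => Complex.sin (k * (x0 - t)) / k) (Y := Y)
    (α := 1 / ‖k‖) (β := β) (τ := |k.im|) hV (by positivity) hβ0 hQ hx0 (fun t ht => by
      rw [norm_div, div_mul_eq_mul_div, one_mul]
      refine div_le_div_of_nonneg_right ?_ hk'.le
      rw [← abs_im_mul_sub k ht.2]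
      exact norm_sin_le _) (fun t ht => hY t ⟨ht.1, ht.2.trans hx0.2⟩)
  have e3 : ‖Y x0‖ ≤ (1 / ‖k‖ + 1 / ‖k‖ * β * Q) * Real.exp (|k.im| * x0) := by
    rw [hb]
    refine (norm_add_le _ _).trans ((add_le_add e1 e2).trans (le_of_eq (by ring)))
  have e4 : β ≤ 1 / ‖k‖ + 1 / ‖k‖ * β * Q := by
    have : ‖Y x0‖ = β * Real.exp (|k.im| * x0) := by
      rw [hβ, mul_assoc, ← Real.exp_add, neg_add_cancel, Real.exp_zero, mul_one]
    rw [this] at e3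
    exact le_of_mul_le_mul_right e3 (Real.exp_pos _)
  have e5 : 1 / ‖k‖ * β * Q ≤ β / 2 := by
    rw [div_mul_eq_mul_div, div_mul_eq_mul_div, div_le_div_iff₀ hk' two_pos]
    nlinarith
  refine (hY x hx).trans (mul_le_mul_of_nonneg_right ?_ (Real.exp_pos _).le)
  have : 2 / ‖k‖ = 2 * (1 / ‖k‖) := by ring
  rw [this]
  linarith

/-- The a priori bound `norm_le` is inserted into the integral term of variation of constants. -/
lemma Sol.norm_sub_sin_le {x : ℝ} (hx : x ∈ Icc (0 : ℝ) 1) :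
    ‖Y x - (Complex.sin (k * x) / k) • (1 : A)‖ ≤
      2 * Q / ‖k‖ ^ 2 * Real.exp (|k.im| * x) := by
  have hk' : 0 < ‖k‖ := norm_pos_iff.2 hk
  nth_rw 1 [h.variation hk h0 h1 hx]
  rw [add_sub_cancel_left]
  refine (norm_integral_smul_le (α := 1 / ‖k‖) (β := 2 / ‖k‖) (τ := |k.im|) hV (by positivity)
    (by positivity) hQ hx (fun t ht => ?_) (fun t ht => ?_)).trans (le_of_eq ?_)
  · rw [norm_div, div_mul_eq_mul_div, one_mul]
    refine div_le_div_of_nonneg_right ?_ hk'.le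
    rw [← abs_im_mul_sub k ht.2]
    exact norm_sin_le _
  · exact h.norm_le hV hQ hk hkQ h0 h1 ⟨ht.1, ht.2.trans hx.2⟩
  · field_simp

lemma Sol.norm_sub_cos_le {x : ℝ} (hx : x ∈ Icc (0 : ℝ) 1) :
    ‖Y' x - Complex.cos (k * x) • (1 : A)‖ ≤ 2 * Q / ‖k‖ * Real.exp (|k.im| * x) := by
  have hk' : 0 < ‖k‖ := norm_pos_iff.2 hk
  rw [h.variation_deriv hk h0 h1 hx, add_sub_cancel_left]
  refine (norm_integral_smul_le (α := 1) (β := 2 / ‖k‖) (τ := |k.im|) hV (by positivity)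
    (by positivity) hQ hx (fun t ht => ?_) (fun t ht => ?_)).trans (le_of_eq ?_)
  · rw [one_mul, ← abs_im_mul_sub k ht.2]
    exact norm_cos_le _
  · exact h.norm_le hV hQ hk hkQ h0 h1 ⟨ht.1, ht.2.trans hx.2⟩
  · field_simp

end Sine

/-- The Weyl solution is, up to a factor, the sine solution from the right end. -/
lemma Sol.exists_reflected_factor {V : ℝ → A} (hV : IntervalIntegrable V volume 0 1) {lam : ℂ}
    {Ψ Ψ' : ℝ → A} (h : Sol V lam Ψ Ψ') (h1 : Ψ 1 = 0) :
    ∃ (Y Y' : ℝ → A) (m : A), Sol (fun x => V (1 - x)) lam Y Y' ∧ Y 0 = 0 ∧ Y' 0 = 1 ∧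
      ∀ x ∈ Icc (0 : ℝ) 1, Ψ x = Y (1 - x) * m ∧ Ψ' x = -(Y' (1 - x) * m) := by
  have hV' : IntervalIntegrable (fun x => V (1 - x)) volume 0 1 := by
    simpa using (hV.comp_sub_left 1).symm
  have hY := sol_isSol hV' 0 1 lam
  refine ⟨_, _, -Ψ' 1, hY, sol_zero .., dsol_zero .., fun x hx => ?_⟩
  have hx' : 1 - x ∈ Icc (0 : ℝ) 1 := ⟨by linarith [hx.2], by linarith [hx.1]⟩
  have := Sol.unique hV' h.reflect (hY.mul_const (-Ψ' 1)) (by simp [h1, sol_zero])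
    (by simp [dsol_zero]) hx'
  simp only [sub_sub_cancel] at this
  exact ⟨this.1, by rw [← this.2, neg_neg]⟩

/-! ### Bounds for the Weyl solution at large `k` -/

section Weyl

variable {V : ℝ → A} (hV : IntervalIntegrable V volume 0 1) {Q : ℝ}
  (hQ : ∫ t in (0 : ℝ)..1, ‖V t‖ ≤ Q) {k : ℂ} (hk : k ≠ 0) (hkQ : 16 * Q ≤ ‖k‖)
  (hsin : Real.exp |k.im| / 4 ≤ ‖Complex.sin k‖)
  {Ψ Ψ' : ℝ → A} (h : Sol V (k ^ 2) Ψ Ψ') (h0 : Ψ 0 = 1) (h1 : Ψ 1 = 0)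

include hV hQ hk hkQ hsin h h0 h1

/-- Here `Ψ(x) = Y(1-x) m`, where `Y` is the sine solution of the reflected problem and `Y(1) m =
1`. Since `Y(1)` is close to `sin k / k`, the factor `m` is close to `k / sin k`; its size `exp(-|Im
k|)` beats the growth of `Y(1-x)` and leaves decay in `x`. -/
lemma Sol.norm_weyl_sub_le {x : ℝ} (hx : x ∈ Icc (0 : ℝ) 1) :
    ‖Ψ x - (Complex.sin (k * ((1 : ℝ) - x)) / Complex.sin k) • (1 : A)‖ ≤
      80 * Q / ‖k‖ * Real.exp (-(|k.im| * x)) ∧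
    ‖Ψ' x - (-k * Complex.cos (k * ((1 : ℝ) - x)) / Complex.sin k) • (1 : A)‖ ≤
      80 * Q * Real.exp (-(|k.im| * x)) := by
  have hk' : 0 < ‖k‖ := norm_pos_iff.2 hk
  have hQ0 : 0 ≤ Q :=
    (intervalIntegral.integral_nonneg zero_le_one fun _ _ => norm_nonneg _).trans hQ
  have hV' : IntervalIntegrable (fun x => V (1 - x)) volume 0 1 := by
    simpa using (hV.comp_sub_left 1).symm
  have hQ' : ∫ t in (0 : ℝ)..1, ‖V (1 - t)‖ ≤ Q := by
    rw [intervalIntegral.integral_comp_sub_left (fun t => ‖V t‖)]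
    simpa using hQ
  have hkQ' : 2 * Q ≤ ‖k‖ := by linarith
  obtain ⟨Y, Y', m, hY, hY0, hY1, hYm⟩ := h.exists_reflected_factor hV h1
  set s := Complex.sin k with hs
  set e := Real.exp |k.im| with he
  have he0 : 0 < e := Real.exp_pos _
  have hs0 : 0 < ‖s‖ := lt_of_lt_of_le (by positivity) hsin
  have hs0' : s ≠ 0 := norm_pos_iff.1 hs0
  have hm1 : Y 1 * m = 1 := by
    have := (hYm 0 unitInterval.zero_mem).1
    rw [sub_zero, h0] at this
    exact this.symm
  have hd := hY.norm_sub_sin_le hV' hQ' hk hkQ' hY0 hY1 unitInterval.one_mem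
  rw [Complex.ofReal_one, mul_one, mul_one, ← hs, ← he] at hd
  set δ := Y 1 - (s / k) • (1 : A) with hδ
  have hm2 : (s / k) • m = 1 - δ * m := by
    rw [hδ, sub_mul, hm1, smul_mul_assoc, one_mul]
    abel
  have hδm : ‖δ * m‖ ≤ 2 * Q / ‖k‖ ^ 2 * e * ‖m‖ :=
    (norm_mul_le _ _).trans (mul_le_mul_of_nonneg_right hd (norm_nonneg _))
  -- The condition `16 Q ≤ |k|` makes the error in `Y 1` at most half of the lower bound `e /
  -- (4|k|)` for `|sin k / k|`.
  have hm3 : ‖m‖ ≤ 8 * ‖k‖ / e := by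
    have e1 : ‖s‖ / ‖k‖ * ‖m‖ ≤ 1 + 2 * Q / ‖k‖ ^ 2 * e * ‖m‖ := by
      rw [← norm_div, ← norm_smul, hm2]
      refine (norm_sub_le _ _).trans ?_
      rw [norm_one]
      linarith
    have e2 : e / 4 / ‖k‖ * ‖m‖ ≤ ‖s‖ / ‖k‖ * ‖m‖ := by gcongr
    have e3 : 2 * Q / ‖k‖ ^ 2 * e * ‖m‖ ≤ e / 8 / ‖k‖ * ‖m‖ := by
      refine mul_le_mul_of_nonneg_right ?_ (norm_nonneg _)
      rw [div_mul_eq_mul_div, div_div, div_le_div_iff₀ (by positivity) (by positivity)]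
      have := mul_le_mul_of_nonneg_right hkQ (mul_nonneg he0.le hk'.le)
      nlinarith
    have e4 : e / 8 / ‖k‖ * ‖m‖ ≤ 1 := by
      have : e / 4 / ‖k‖ * ‖m‖ = 2 * (e / 8 / ‖k‖ * ‖m‖) := by ring
      linarith
    rw [le_div_iff₀ he0]
    have : e / 8 / ‖k‖ * ‖m‖ = (‖m‖ * e) / (8 * ‖k‖) := by field_simp
    rw [this, div_le_one (by positivity)] at e4
    exact e4
  have hm4 : ‖m - (k / s) • (1 : A)‖ ≤ 64 * Q / e := by
    have e1 : m - (k / s) • (1 : A) = -((k / s) • (δ * m)) := by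
      have hm5 : m = (k / s) • ((s / k) • m) := by
        rw [smul_smul, div_mul_div_cancel₀ hs0', div_self hk, one_smul]
      rw [hm2] at hm5
      calc m - (k / s) • (1 : A) = (k / s) • (1 - δ * m) - (k / s) • (1 : A) := by rw [← hm5]
        _ = _ := by rw [smul_sub]; abel
    rw [e1, norm_neg, norm_smul, norm_div]
    calc ‖k‖ / ‖s‖ * ‖δ * m‖ ≤ ‖k‖ / (e / 4) * (2 * Q / ‖k‖ ^ 2 * e * (8 * ‖k‖ / e)) := by
          gcongr
          exact hδm.trans (by gcongr)
      _ = 64 * Q / e := by field_simp; ring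
  have hx' : 1 - x ∈ Icc (0 : ℝ) 1 := ⟨by linarith [hx.2], by linarith [hx.1]⟩
  set e' := Real.exp (|k.im| * (1 - x)) with he'
  have he'0 : 0 < e' := Real.exp_pos _
  have hee : e' / e = Real.exp (-(|k.im| * x)) := by
    rw [he, he', ← Real.exp_sub]
    congr 1
    ring
  have hsx : ‖Complex.sin (k * ((1 : ℝ) - x))‖ ≤ e' := by
    rw [he', ← abs_im_mul_sub k hx.2]
    exact norm_sin_le _
  have hcx : ‖Complex.cos (k * ((1 : ℝ) - x))‖ ≤ e' := by
    rw [he', ← abs_im_mul_sub k hx.2]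
    exact norm_cos_le _
  have hd1 := hY.norm_sub_sin_le hV' hQ' hk hkQ' hY0 hY1 hx'
  have hd2 := hY.norm_sub_cos_le hV' hQ' hk hkQ' hY0 hY1 hx'
  rw [Complex.ofReal_sub, ← he'] at hd1 hd2
  rw [(hYm x hx).1, (hYm x hx).2, ← hee]
  set sx := Complex.sin (k * ((1 : ℝ) - x))
  set cx := Complex.cos (k * ((1 : ℝ) - x))
  constructor
  · have e1 : Y (1 - x) * m - (sx / s) • (1 : A) = (Y (1 - x) - (sx / k) • (1 : A)) * m +
        (sx / k) • (m - (k / s) • (1 : A)) := by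
      rw [sub_mul, smul_sub, smul_smul, smul_mul_assoc, one_mul, div_mul_div_cancel₀ hk]
      abel
    rw [e1]
    -- The constant is `80 = 16 + 64`: the error in `Y` times `m`, plus the main term times the
    -- error in `m`.
    calc _ ≤ 2 * Q / ‖k‖ ^ 2 * e' * (8 * ‖k‖ / e) + e' / ‖k‖ * (64 * Q / e) := by
          refine (norm_add_le _ _).trans (add_le_add ((norm_mul_le _ _).trans ?_) ?_)
          · gcongr
          · rw [norm_smul, norm_div]
            gcongr
      _ = _ := by field_simp; ring
  · have e1 : -(Y' (1 - x) * m) - (-k * cx / s) • (1 : A) =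
        -((Y' (1 - x) - cx • (1 : A)) * m + cx • (m - (k / s) • (1 : A))) := by
      rw [sub_mul, smul_sub, smul_smul, smul_mul_assoc, one_mul,
        show -k * cx / s = -(cx * (k / s)) by ring, neg_smul]
      abel
    rw [e1, norm_neg]
    calc _ ≤ 2 * Q / ‖k‖ * e' * (8 * ‖k‖ / e) + e' * (64 * Q / e) := by
          refine (norm_add_le _ _).trans (add_le_add ((norm_mul_le _ _).trans ?_) ?_)
          · gcongr
          · rw [norm_smul]
            gcongr
      _ = _ := by field_simp; ring

end Weyl

end Asymptotics

/-! ### Circles avoiding the zeros of the sine, and Liouville's theorem -/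

section Circles

/-- The radii of circles on which `|sin k|` is bounded below by `exp |Im k| / 4`. -/
def radius (n : ℕ) : ℝ := (n + 1 / 2) * Real.pi

lemma one_lt_radius (n : ℕ) : 1 < radius n := by
  have := Real.pi_gt_three
  have : (0 : ℝ) ≤ n := n.cast_nonneg
  unfold radius
  nlinarith

lemma tendsto_radius : Tendsto radius atTop atTop :=
  (tendsto_atTop_add_const_right _ _ tendsto_natCast_atTop_atTop).atTop_mul_const Real.pi_pos

/-- If `|Im k| ≥ 1`, one exponential in `sin k` dominates the other. Otherwise `|Re k|` is within
`2/3` of `(n + 1/2) π`, so `|sin (Re k)| ≥ 1/2`, and `|Re sin k| = |sin (Re k)| cosh (Im k)`. -/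
lemma exp_div_four_le_norm_sin {k : ℂ} {n : ℕ} (hk : ‖k‖ = radius n) :
    Real.exp |k.im| / 4 ≤ ‖Complex.sin k‖ := by
  rcases le_or_gt 1 |k.im| with h | h
  · have h1 : Real.exp |k.im| - Real.exp (-|k.im|) ≤
        ‖Complex.exp (-k * Complex.I) - Complex.exp (k * Complex.I)‖ := by
      have e1 : ‖Complex.exp (-k * Complex.I)‖ = Real.exp k.im := by
        rw [Complex.norm_exp]; simp
      have e2 : ‖Complex.exp (k * Complex.I)‖ = Real.exp (-k.im) := by
        rw [Complex.norm_exp]; simp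
      have n1 := norm_sub_norm_le (Complex.exp (-k * Complex.I)) (Complex.exp (k * Complex.I))
      have n2 := norm_sub_norm_le (Complex.exp (k * Complex.I)) (Complex.exp (-k * Complex.I))
      rw [norm_sub_rev] at n2
      rw [e1, e2] at n1 n2
      rcases abs_cases k.im with ⟨h, _⟩ | ⟨h, _⟩ <;> rw [h]
      · exact n1
      · rwa [neg_neg]
    have h2 : Real.exp (-|k.im|) ≤ Real.exp |k.im| / 2 := by
      have e3 : Real.exp |k.im| = Real.exp (-|k.im|) * Real.exp (2 * |k.im|) := by
        rw [← Real.exp_add]; ring_nf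
      have e4 : 2 ≤ Real.exp (2 * |k.im|) := by
        linarith [Real.add_one_le_exp (2 * |k.im|)]
      rw [e3]
      nlinarith [Real.exp_pos (-|k.im|)]
    rw [Complex.sin, norm_div, norm_mul, Complex.norm_I, mul_one, Complex.norm_ofNat]
    linarith
  · have hR := one_lt_radius n
    have hpi := Real.pi_gt_three
    have hn : (0 : ℝ) ≤ n := n.cast_nonneg
    have hR' : 3 / 2 ≤ radius n := by unfold radius; nlinarith
    set a := |k.re| with ha
    have ha0 : 0 ≤ a := abs_nonneg _
    have hsq : a ^ 2 + |k.im| ^ 2 = radius n ^ 2 := by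
      rw [← hk, ha, sq_abs, sq_abs, Complex.sq_norm, Complex.normSq_apply]
      ring
    have haR : a ≤ radius n := by nlinarith [abs_nonneg k.im]
    set d := radius n - a with hd
    have hd0 : 0 ≤ d := by linarith
    have hd1 : d ≤ 2 / 3 := by
      by_contra! hcon
      -- With the right side below `1` and the radius at least `3/2`, this forces `d < 2/3`.
      have : d * (radius n + a) = |k.im| ^ 2 := by rw [hd]; linarith
      have : |k.im| ^ 2 < 1 := by nlinarith [abs_nonneg k.im]
      nlinarith
    have hcos : 1 / 2 ≤ Real.cos d := by
      have := Real.one_sub_sq_div_two_le_cos (x := d)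
      nlinarith
    have hsin : 1 / 2 ≤ |Real.sin k.re| := by
      have e1 : |Real.sin k.re| = |Real.sin a| := by
        rcases abs_cases k.re with ⟨h, _⟩ | ⟨h, _⟩
        · rw [ha, h]
        · rw [ha, h, Real.sin_neg, abs_neg]
      have e2 : Real.sin a = (-1) ^ n * Real.cos d := by
        have : a = (Real.pi / 2 - d) + n * Real.pi := by rw [hd, radius]; ring
        rw [this, Real.sin_add_nat_mul_pi, Real.sin_pi_div_two_sub]
      rw [e1, e2, abs_mul, abs_pow, abs_neg, abs_one, one_pow, one_mul]
      exact hcos.trans (le_abs_self _)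
    have hcosh : Real.exp |k.im| / 2 ≤ Real.cosh k.im := by
      rw [← Real.cosh_abs, Real.cosh_eq]
      linarith [Real.exp_pos (-|k.im|)]
    have hre : (Complex.sin k).re = Real.sin k.re * Real.cosh k.im := by
      rw [Complex.sin_eq, ← Complex.ofReal_sin, ← Complex.ofReal_cosh, ← Complex.ofReal_cos,
        ← Complex.ofReal_sinh, ← Complex.ofReal_mul, ← Complex.ofReal_mul, Complex.add_re,
        Complex.ofReal_re, Complex.re_ofReal_mul, Complex.I_re, mul_zero, add_zero]
    refine le_trans ?_ (Complex.abs_re_le_norm _)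
    rw [hre, abs_mul, abs_of_pos (Real.cosh_pos _)]
    have := mul_le_mul hsin hcosh (by positivity) (abs_nonneg _)
    linarith

lemma exists_sq_eq_of_norm_eq {lam : ℂ} {r : ℝ} (hr : 0 ≤ r) (h : ‖lam‖ = r ^ 2) :
    ∃ k : ℂ, k ^ 2 = lam ∧ ‖k‖ = r := by
  obtain ⟨k, hk⟩ := IsAlgClosed.exists_pow_nat_eq lam (n := 2) two_pos
  refine ⟨k, hk, ?_⟩
  rw [← hk, norm_pow] at h
  exact (sq_eq_sq₀ (norm_nonneg _) hr).1 h

/-- A Liouville theorem with bounds on a sequence of circles only. -/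
lemma eq_zero_of_circle_bound {E : Type*} [NormedAddCommGroup E] [NormedSpace ℂ E]
    {F : ℂ → E} (hF : Differentiable ℂ F) {C : ℝ} {n₀ : ℕ}
    (h : ∀ n ≥ n₀, ∀ lam : ℂ, ‖lam‖ = radius n ^ 2 → ‖F lam‖ ≤ C / radius n) (lam : ℂ) :
    F lam = 0 := by
  have hlim : Tendsto (fun n => C / radius n) atTop (𝓝 0) :=
    tendsto_const_nhds.div_atTop tendsto_radius
  rw [← norm_le_zero_iff]
  refine ge_of_tendsto hlim ?_
  filter_upwards [eventually_ge_atTop n₀, tendsto_radius.eventually_gt_atTop ‖lam‖] with n hn hr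
  have hR := one_lt_radius n
  have hR2 : (radius n) ^ 2 ≠ 0 := by positivity
  refine Complex.norm_le_of_forall_mem_frontier_norm_le (U := Metric.ball 0 (radius n ^ 2))
    Metric.isBounded_ball hF.diffContOnCl (fun z hz => h n hn z ?_) (subset_closure ?_)
  · rw [frontier_ball _ hR2, mem_sphere_zero_iff_norm] at hz
    exact hz
  · rw [mem_ball_zero_iff]
    nlinarith

end Circles

/-! ### Estimates of the transition between two potentials -/

section Bounds

variable {A : Type*} [NormedRing A] [NormedAlgebra ℂ A] [CompleteSpace A] [NormOneClass A]

/-- In use `u` and `v` are `exp(± |Im k| x)`: the growth of the sine solution and the decay of the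
Weyl solution cancel in products. -/
lemma norm_mul_sub_smul_one_le {a b : A} {α β : ℂ} {p q α' β' u v : ℝ}
    (huv : u * v = 1) (ha : ‖a - α • (1 : A)‖ ≤ p * u) (hb : ‖b - β • (1 : A)‖ ≤ q * v)
    (hα : ‖α‖ ≤ α' * u) (hβ : ‖β‖ ≤ β' * v) :
    ‖a * b - (α * β) • (1 : A)‖ ≤ p * q + α' * q + β' * p := by
  have e : a * b - (α * β) • (1 : A) = (a - α • (1 : A)) * (b - β • (1 : A)) +
      α • (b - β • (1 : A)) + β • (a - α • (1 : A)) := by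
    simp only [sub_mul, mul_sub, smul_sub, smul_mul_assoc, mul_smul_comm, one_mul, mul_one,
      smul_smul, mul_comm β α]
    abel
  rw [e]
  have h1 : ‖(a - α • (1 : A)) * (b - β • (1 : A))‖ ≤ (p * u) * (q * v) :=
    (norm_mul_le _ _).trans (mul_le_mul ha hb (norm_nonneg _) ((norm_nonneg _).trans ha))
  have h2 : ‖α • (b - β • (1 : A))‖ ≤ (α' * u) * (q * v) := by
    rw [norm_smul]
    exact mul_le_mul hα hb (norm_nonneg _) ((norm_nonneg _).trans hα)
  have h3 : ‖β • (a - α • (1 : A))‖ ≤ (β' * v) * (p * u) := by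
    rw [norm_smul]
    exact mul_le_mul hβ ha (norm_nonneg _) ((norm_nonneg _).trans hβ)
  calc _ ≤ (p * u) * (q * v) + (α' * u) * (q * v) + (β' * v) * (p * u) :=
        (norm_add₃_le).trans (add_le_add (add_le_add h1 h2) h3)
    _ = (p * q + α' * q + β' * p) * (u * v) := by ring
    _ = _ := by rw [huv, mul_one]

variable [StarRing A] [NormedStarGroup A] [StarModule ℂ A]

lemma norm_star_sub_smul_one {a : A} {α : ℂ} :
    ‖star a - α • (1 : A)‖ = ‖a - star α • (1 : A)‖ := by
  rw [← norm_star (a - star α • (1 : A)), star_sub, star_smul, star_one, star_star]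

/-- On the circles, the entries of the transition matrix between two potentials tend to those of
the identity. -/
lemma norm_transition_le {V W : ℝ → A} (hV : IntervalIntegrable V volume 0 1)
    (hW : IntervalIntegrable W volume 0 1) {Q : ℝ} (hVQ : ∫ t in (0 : ℝ)..1, ‖V t‖ ≤ Q)
    (hWQ : ∫ t in (0 : ℝ)..1, ‖W t‖ ≤ Q) {k : ℂ} {n : ℕ} (hk : ‖k‖ = radius n)
    (hkQ : 16 * Q ≤ radius n) {φ φ' Ψ Ψ' χ χ' Ξ Ξ' : ℝ → A}
    (hφ : Sol W (k ^ 2) φ φ') (hφ0 : φ 0 = 0) (hφ1 : φ' 0 = 1)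
    (hΨ : Sol W (k ^ 2) Ψ Ψ') (hΨ0 : Ψ 0 = 1) (hΨ1 : Ψ 1 = 0)
    (hχ : Sol V (star k ^ 2) χ χ') (hχ0 : χ 0 = 0) (hχ1 : χ' 0 = 1)
    (hΞ : Sol V (star k ^ 2) Ξ Ξ') (hΞ0 : Ξ 0 = 1) (hΞ1 : Ξ 1 = 0)
    {x : ℝ} (hx : x ∈ Icc (0 : ℝ) 1) :
    ‖Ψ x * star (χ x) - φ x * star (Ξ x)‖ ≤ (320 * Q ^ 2 + 176 * Q) / radius n ∧
    ‖φ x * star (Ξ' x) - Ψ x * star (χ' x) + 1‖ ≤ (320 * Q ^ 2 + 176 * Q) / radius n := by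
  have hR := one_lt_radius n
  have hk0' : 0 < ‖k‖ := by rw [hk]; linarith
  have hk0 : k ≠ 0 := norm_pos_iff.1 hk0'
  have hQ0 : 0 ≤ Q :=
    (intervalIntegral.integral_nonneg zero_le_one fun _ _ => norm_nonneg _).trans hVQ
  have hks0 : star k ≠ 0 := star_ne_zero.2 hk0
  have hks : ‖star k‖ = radius n := by rw [norm_star, hk]
  have him : |(star k).im| = |k.im| := by
    rw [Complex.star_def, Complex.conj_im, abs_neg]
  have hsin := exp_div_four_le_norm_sin hk
  have hsin' := exp_div_four_le_norm_sin hks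
  have hs0 : Complex.sin k ≠ 0 :=
    norm_pos_iff.1 (lt_of_lt_of_le (by positivity) hsin)
  have b1 := hφ.norm_sub_sin_le hW hWQ hk0 (by rw [hk]; linarith) hφ0 hφ1 hx
  have b2 := hΨ.norm_weyl_sub_le hW hWQ hk0 (by rw [hk]; linarith) hsin hΨ0 hΨ1 hx
  have b3 := hχ.norm_sub_sin_le hV hVQ hks0 (by rw [hks]; linarith) hχ0 hχ1 hx
  have b4 := hχ.norm_sub_cos_le hV hVQ hks0 (by rw [hks]; linarith) hχ0 hχ1 hx
  have b5 := hΞ.norm_weyl_sub_le hV hVQ hks0 (by rw [hks]; linarith) hsin' hΞ0 hΞ1 hx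
  set s := Complex.sin (k * x) / k with hs
  set γ := Complex.cos (k * x) with hγ
  set σ := Complex.sin (k * ((1 : ℝ) - x)) / Complex.sin k with hσ
  set ρ := -k * Complex.cos (k * ((1 : ℝ) - x)) / Complex.sin k with hρ
  have c3 : Complex.sin (star k * x) / star k = star s := by
    rw [hs]
    simp only [Complex.star_def, map_div₀, ← Complex.sin_conj, map_mul, Complex.conj_ofReal]
  have c4 : Complex.cos (star k * x) = star γ := by
    rw [hγ]
    simp only [Complex.star_def, ← Complex.cos_conj, map_mul, Complex.conj_ofReal]
  have c5 : Complex.sin (star k * ((1 : ℝ) - x)) / Complex.sin (star k) = star σ := by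
    rw [hσ]
    simp only [Complex.star_def, map_div₀, ← Complex.sin_conj, map_mul, map_sub,
      Complex.conj_ofReal]
  have c6 : -star k * Complex.cos (star k * ((1 : ℝ) - x)) / Complex.sin (star k) = star ρ := by
    rw [hρ]
    simp only [Complex.star_def, map_div₀, ← Complex.sin_conj, ← Complex.cos_conj, map_mul,
      map_sub, map_neg, Complex.conj_ofReal]
  rw [c3, norm_star, him, ← norm_star_sub_smul_one] at b3
  rw [c4, norm_star, him, ← norm_star_sub_smul_one] at b4
  rw [c5, c6, norm_star, him, ← norm_star_sub_smul_one, ← norm_star_sub_smul_one] at b5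
  set e := Real.exp (|k.im| * x) with he
  set e' := Real.exp (-(|k.im| * x)) with he'
  have he0 : 0 ≤ e := (Real.exp_pos _).le
  have he'0 : 0 ≤ e' := (Real.exp_pos _).le
  have hee : e * e' = 1 := by rw [he, he', ← Real.exp_add]; simp
  have hee' : e' * e = 1 := by rw [mul_comm, hee]
  have hexp : Real.exp (|k.im| * (1 - x)) = e' * Real.exp |k.im| := by
    rw [he', ← Real.exp_add]; ring_nf
  have ns : ‖s‖ ≤ 1 / ‖k‖ * e := by
    rw [hs, norm_div, he, ← abs_im_mul_ofReal k hx.1, div_mul_eq_mul_div, one_mul]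
    exact div_le_div_of_nonneg_right (norm_sin_le _) hk0'.le
  have nγ : ‖γ‖ ≤ 1 * e := by
    rw [hγ, one_mul, he, ← abs_im_mul_ofReal k hx.1]
    exact norm_cos_le _
  have hse : 0 < ‖Complex.sin k‖ := norm_pos_iff.2 hs0
  have nσ : ‖σ‖ ≤ 4 * e' := by
    rw [hσ, norm_div, div_le_iff₀ hse]
    have := norm_sin_le (k * ((1 : ℝ) - x))
    rw [abs_im_mul_sub k hx.2, hexp] at this
    nlinarith
  have nρ : ‖ρ‖ ≤ 4 * ‖k‖ * e' := by
    rw [hρ, norm_div, div_le_iff₀ hse, norm_mul, norm_neg]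
    have := norm_cos_le (k * ((1 : ℝ) - x))
    rw [abs_im_mul_sub k hx.2, hexp] at this
    have h2 : ‖Complex.cos (k * ((1 : ℝ) - x))‖ ≤ 4 * e' * ‖Complex.sin k‖ := by nlinarith
    calc _ ≤ ‖k‖ * (4 * e' * ‖Complex.sin k‖) := by gcongr
      _ = _ := by ring
  have p1 := norm_mul_sub_smul_one_le hee' b2.1 b3 nσ ns
  have p2 := norm_mul_sub_smul_one_le hee b1 b5.1 ns nσ
  have p3 := norm_mul_sub_smul_one_le hee b1 b5.2 ns nρ
  have p4 := norm_mul_sub_smul_one_le hee' b2.1 b4 nσ nγ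
  have hk1 : 1 ≤ ‖k‖ := by rw [hk]; exact hR.le
  rw [← hk]
  constructor
  · have e1 : Ψ x * star (χ x) - φ x * star (Ξ x) =
        (Ψ x * star (χ x) - (σ * s) • (1 : A)) - (φ x * star (Ξ x) - (s * σ) • (1 : A)) := by
      rw [mul_comm s σ]; abel
    rw [e1]
    refine (norm_sub_le _ _).trans ((add_le_add p1 p2).trans ?_)
    rw [le_div_iff₀ hk0']
    have e2 : (80 * Q / ‖k‖ * (2 * Q / ‖k‖ ^ 2) + 4 * (2 * Q / ‖k‖ ^ 2) +
        1 / ‖k‖ * (80 * Q / ‖k‖) + (2 * Q / ‖k‖ ^ 2 * (80 * Q / ‖k‖) +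
        1 / ‖k‖ * (80 * Q / ‖k‖) + 4 * (2 * Q / ‖k‖ ^ 2))) * ‖k‖ =
        320 * Q ^ 2 / ‖k‖ ^ 2 + 176 * Q / ‖k‖ := by
      field_simp; ring
    rw [e2]
    exact add_le_add (div_le_self (by positivity) (one_le_pow₀ hk1))
      (div_le_self (by positivity) hk1)
  · have e1 : φ x * star (Ξ' x) - Ψ x * star (χ' x) + 1 =
        (φ x * star (Ξ' x) - (s * ρ) • (1 : A)) - (Ψ x * star (χ' x) - (σ * γ) • (1 : A)) := by
      -- The Wronskian for zero potential, which is the addition formula for the sine; it cancels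
      -- the `1` in the statement.
      have : σ * γ - s * ρ = 1 := by
        have e0 : k = k * ((1 : ℝ) - x) + k * x := by push_cast; ring
        have : Complex.sin k = Complex.sin (k * ((1 : ℝ) - x)) * Complex.cos (k * x) +
            Complex.cos (k * ((1 : ℝ) - x)) * Complex.sin (k * x) := by
          rw [← Complex.sin_add, ← e0]
        rw [hσ, hγ, hs, hρ]
        field_simp
        rw [this]
        ring
      have h1 : (1 : A) = (σ * γ) • (1 : A) - (s * ρ) • (1 : A) := by
        rw [← sub_smul, this, one_smul]
      nth_rw 1 [h1]
      abel
    rw [e1]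
    refine (norm_sub_le _ _).trans ((add_le_add p3 p4).trans ?_)
    rw [le_div_iff₀ hk0']
    have e2 : (2 * Q / ‖k‖ ^ 2 * (80 * Q) + 1 / ‖k‖ * (80 * Q) + 4 * ‖k‖ * (2 * Q / ‖k‖ ^ 2) +
        (80 * Q / ‖k‖ * (2 * Q / ‖k‖) + 4 * (2 * Q / ‖k‖) + 1 * (80 * Q / ‖k‖))) * ‖k‖ =
        320 * Q ^ 2 / ‖k‖ + 176 * Q := by
      field_simp; ring
    rw [e2]
    exact add_le_add (div_le_self (by positivity) hk1) le_rfl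

end Bounds

/-! ### Removable singularities; invertibility in finite dimension -/

section Removable

/-- A function which is differentiable and bounded in a punctured neighbourhood of every point
extends to an entire function. -/
lemma exists_entire_extension {E : Type*} [NormedAddCommGroup E] [NormedSpace ℂ E]
    [CompleteSpace E] {f : ℂ → E} (hd : ∀ c, ∀ᶠ z in 𝓝[≠] c, DifferentiableAt ℂ f z)
    (hb : ∀ c, ∃ B, ∀ᶠ z in 𝓝[≠] c, ‖f z‖ ≤ B) :
    ∃ g : ℂ → E, Differentiable ℂ g ∧ ∀ z, DifferentiableAt ℂ f z → g z = f z := by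
  have hlim : ∀ z, DifferentiableAt ℂ f z → limUnder (𝓝[≠] z) f = f z := fun z hz =>
    have h : Tendsto f (𝓝[≠] z) (𝓝 (f z)) :=
      hz.continuousAt.tendsto.mono_left nhdsWithin_le_nhds
    h.limUnder_eq
  -- The punctured limit ignores the value of `f` at `z`, which at a pole of a Weyl function is a
  -- mere default of `Ring.inverse`.
  refine ⟨fun z => limUnder (𝓝[≠] z) f, fun c => ?_, hlim⟩
  obtain ⟨B, hB⟩ := hb c
  obtain ⟨s, hs, hsf⟩ := (nhdsWithin_basis_open c {c}ᶜ).mem_iff.1 ((hd c).and hB)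
  have hsn : s ∈ 𝓝 c := hs.2.mem_nhds hs.1
  have h := Complex.differentiableOn_update_limUnder_of_bddAbove (f := f) hsn
    (fun z hz => (hsf hz).1.differentiableWithinAt)
    ⟨B, by rintro _ ⟨z, hz, rfl⟩; exact (hsf hz).2⟩
  refine (h.differentiableAt hsn).congr_of_eventuallyEq ?_
  filter_upwards [hsn] with z hz
  rcases eq_or_ne z c with rfl | hzc
  · simp
  · rw [Function.update_of_ne hzc]
    exact hlim z (hsf ⟨hz, hzc⟩).1

/-- Left multiplication by `a` is injective, hence surjective in finite dimension. All invertibility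
claims about solutions below are reduced to this. -/
lemma isUnit_of_mul_eq_zero {A : Type*} [Ring A] [Algebra ℂ A] [FiniteDimensional ℂ A] {a : A}
    (h : ∀ m, a * m = 0 → m = 0) : IsUnit a := by
  have hinj : Function.Injective (LinearMap.mulLeft ℂ a) := by
    rw [injective_iff_map_eq_zero]
    exact h
  obtain ⟨b, hb⟩ := LinearMap.injective_iff_surjective.1 hinj 1
  rw [LinearMap.mulLeft_apply] at hb
  refine ⟨⟨a, b, hb, sub_eq_zero.1 (h _ ?_)⟩, rfl⟩
  rw [mul_sub, ← mul_assoc, hb, one_mul, mul_one, sub_self]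

end Removable

/-! ### The Weyl function and its principal part at a real point -/

section Weyl

variable {A : Type*} [NormedRing A] [NormedAlgebra ℂ A] [CompleteSpace A]

variable {V : ℝ → A} (hV : IntervalIntegrable V volume 0 1)

/-- The value at `1` of the solution with `Y 0 = 0`, `Y' 0 = 1`. -/
def charFun (V : ℝ → A) (hV : IntervalIntegrable V volume 0 1) (lam : ℂ) : A :=
  sol V hV 0 1 lam 1

/-- The Weyl function: `weylM = Ψ' 0` for the solution with `Ψ 0 = 1`, `Ψ 1 = 0`. -/
def weylM (V : ℝ → A) (hV : IntervalIntegrable V volume 0 1) (lam : ℂ) : A :=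
  -(Ring.inverse (charFun V hV lam) * sol V hV 1 0 lam 1)

/-- The Weyl solution, with `Ψ 0 = 1` and `Ψ 1 = 0`. -/
def weylSol (V : ℝ → A) (hV : IntervalIntegrable V volume 0 1) (lam : ℂ) (x : ℝ) : A :=
  sol V hV 1 0 lam x + sol V hV 0 1 lam x * weylM V hV lam

/-- The derivative of the Weyl solution. -/
def dweylSol (V : ℝ → A) (hV : IntervalIntegrable V volume 0 1) (lam : ℂ) (x : ℝ) : A :=
  dsol V hV 1 0 lam x + dsol V hV 0 1 lam x * weylM V hV lam

lemma weylSol_isSol (lam : ℂ) : Sol V lam (weylSol V hV lam) (dweylSol V hV lam) :=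
  (sol_isSol hV 1 0 lam).add ((sol_isSol hV 0 1 lam).mul_const _)

lemma weylSol_zero (lam : ℂ) : weylSol V hV lam 0 = 1 := by
  simp [weylSol, sol_zero]

lemma dweylSol_zero (lam : ℂ) : dweylSol V hV lam 0 = weylM V hV lam := by
  simp [dweylSol, dsol_zero]

lemma charFun_mul_weylM {lam : ℂ} (h : IsUnit (charFun V hV lam)) :
    charFun V hV lam * weylM V hV lam = -sol V hV 1 0 lam 1 := by
  rw [weylM, mul_neg, ← mul_assoc, Ring.mul_inverse_cancel _ h, one_mul]

lemma weylSol_one {lam : ℂ} (h : IsUnit (charFun V hV lam)) : weylSol V hV lam 1 = 0 := by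
  rw [weylSol, ← charFun, charFun_mul_weylM hV h, add_neg_cancel]

lemma differentiable_charFun : Differentiable ℂ (charFun V hV) := differentiable_sol hV 0 1 1

lemma differentiableAt_weylM {lam : ℂ} (h : IsUnit (charFun V hV lam)) :
    DifferentiableAt ℂ (weylM V hV) lam :=
  ((DifferentiableAt.inverse (differentiable_charFun hV lam) h).mul
    (differentiable_sol hV 1 0 1 lam)).neg

/-- On the circles the scalar `sin k / k` exceeds in modulus the norm of the error in `Δ(k²)`, so
`Δ(k²) m = 0` forces `m = 0`. -/
lemma isUnit_charFun_of_circle [NormOneClass A] [FiniteDimensional ℂ A] {Q : ℝ}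
    (hQ : ∫ t in (0 : ℝ)..1, ‖V t‖ ≤ Q) {k : ℂ} {n : ℕ} (hk : ‖k‖ = radius n)
    (hkQ : 16 * Q ≤ radius n) : IsUnit (charFun V hV (k ^ 2)) := by
  have hR := one_lt_radius n
  have hk' : 0 < ‖k‖ := by rw [hk]; linarith
  have hk0 : k ≠ 0 := norm_pos_iff.1 hk'
  have hQ0 : 0 ≤ Q :=
    (intervalIntegral.integral_nonneg zero_le_one fun _ _ => norm_nonneg _).trans hQ
  have hsin := exp_div_four_le_norm_sin hk
  have hd := (sol_isSol hV 0 1 (k ^ 2)).norm_sub_sin_le hV hQ hk0 (by rw [hk]; linarith)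
    (sol_zero ..) (dsol_zero ..) unitInterval.one_mem
  rw [Complex.ofReal_one, mul_one, mul_one, ← charFun] at hd
  refine isUnit_of_mul_eq_zero fun m hm => ?_
  set s := Complex.sin k with hs
  set e := Real.exp |k.im| with he
  have he0 : 0 < e := Real.exp_pos _
  have e0 : (s / k) • m = -((charFun V hV (k ^ 2) - (s / k) • (1 : A)) * m) := by
    rw [sub_mul, hm, smul_mul_assoc, one_mul, zero_sub, neg_neg]
  have e1 : ‖s‖ / ‖k‖ * ‖m‖ ≤ 2 * Q / ‖k‖ ^ 2 * e * ‖m‖ := by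
    rw [← norm_div, ← norm_smul, e0, norm_neg]
    exact (norm_mul_le _ _).trans (mul_le_mul_of_nonneg_right hd (norm_nonneg _))
  have e2 : e / 4 / ‖k‖ * ‖m‖ ≤ ‖s‖ / ‖k‖ * ‖m‖ := by gcongr
  have e3 : 2 * Q / ‖k‖ ^ 2 * e * ‖m‖ ≤ e / 8 / ‖k‖ * ‖m‖ := by
    refine mul_le_mul_of_nonneg_right ?_ (norm_nonneg _)
    rw [div_mul_eq_mul_div, div_div, div_le_div_iff₀ (by positivity) (by positivity)]
    rw [← hk] at hkQ
    have := mul_le_mul_of_nonneg_right hkQ (mul_nonneg he0.le hk'.le)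
    nlinarith
  have e4 : e / 4 / ‖k‖ * ‖m‖ = 2 * (e / 8 / ‖k‖ * ‖m‖) := by ring
  have e5 : e / 8 / ‖k‖ * ‖m‖ ≤ 0 := by linarith
  have e6 : 0 < e / 8 / ‖k‖ := by positivity
  exact norm_le_zero_iff.1 (nonpos_of_mul_nonpos_right e5 e6)

variable [StarRing A] [NormedStarGroup A] [StarModule ℂ A]

/-- The Weyl function of a self-adjoint potential is symmetric. -/
lemma star_weylM (hs : ∀ᵐ x, x ∈ Ioc (0 : ℝ) 1 → star (V x) = V x) {lam : ℂ}
    (h1 : IsUnit (charFun V hV lam)) (h2 : IsUnit (charFun V hV (star lam))) :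
    star (weylM V hV (star lam)) = weylM V hV lam := by
  have := (weylSol_isSol hV lam).wronskian_eq hs (star_star lam) (weylSol_isSol hV (star lam))
    unitInterval.one_mem
  rw [weylSol_zero, weylSol_zero, dweylSol_zero, dweylSol_zero, weylSol_one hV h1,
    weylSol_one hV h2] at this
  simp only [star_zero, zero_mul, mul_zero, sub_zero, star_one, one_mul, mul_one] at this
  exact (sub_eq_zero.1 this.symm).symm

variable (A) in
/-- Positive definiteness of the `L²` inner product of continuous `A`-valued functions. -/
def IntegralDefinite : Prop :=
  ∀ (Y : ℝ → A) (x : ℝ), ContinuousOn Y (Icc 0 1) → x ∈ Ioc (0 : ℝ) 1 →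
    ∫ t in (0 : ℝ)..x, star (Y t) * Y t = 0 → ∀ t ∈ Icc (0 : ℝ) x, Y t = 0

/-- Recovers `m = 0` from `φ m = 0` near `0`, because `φ'(0) = 1`. -/
lemma Sol.deriv_zero_eq_zero {lam : ℂ} {Y Y' : ℝ → A} (h : Sol V lam Y Y') {x : ℝ}
    (hx : x ∈ Ioc (0 : ℝ) 1) (h0 : ∀ t ∈ Icc (0 : ℝ) x, Y t = 0) : Y' 0 = 0 := by
  have h1 := h.prim.hasDerivWithinAt h.prim'.continuousOn unitInterval.zero_mem
  have h2 : HasDerivWithinAt Y (Y' 0) (Icc 0 x) 0 := h1.mono (Icc_subset_Icc_right hx.2)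
  have h3 : HasDerivWithinAt Y 0 (Icc 0 x) 0 :=
    (hasDerivWithinAt_const 0 (Icc 0 x) (0 : A)).congr h0 (h0 0 ⟨le_rfl, hx.1.le⟩)
  exact (uniqueDiffOn_Icc hx.1 0 ⟨le_rfl, hx.1.le⟩).eq_deriv _ h2 h3

/-- For nonreal spectral parameters the sine solution is invertible. -/
lemma isUnit_sol_of_im_ne_zero [FiniteDimensional ℂ A] (hA : IntegralDefinite A)
    (hs : ∀ᵐ x, x ∈ Ioc (0 : ℝ) 1 → star (V x) = V x) {lam : ℂ} (hlam : lam.im ≠ 0) {x : ℝ}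
    (hx : x ∈ Ioc (0 : ℝ) 1) : IsUnit (sol V hV 0 1 lam x) := by
  refine isUnit_of_mul_eq_zero fun m hm => ?_
  have hx' : x ∈ Icc (0 : ℝ) 1 := ⟨hx.1.le, hx.2⟩
  have hY := (sol_isSol hV 0 1 lam).mul_const m
  have h := (hY.lagrange hs hY).eq x hx'
  simp only [hm, star_zero, sol_zero, mul_zero, zero_mul, sub_zero, zero_add] at h
  rw [intervalIntegral.integral_smul] at h
  have hne : star lam - lam ≠ 0 := by
    intro h0
    have := congrArg Complex.im h0
    simp only [Complex.star_def, Complex.sub_im, Complex.conj_im, Complex.zero_im] at this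
    exact hlam (by linarith)
  have h' := (smul_eq_zero.1 h.symm).resolve_left hne
  have := hY.deriv_zero_eq_zero hx (hA _ x hY.prim.continuousOn hx h')
  rwa [dsol_zero, one_mul] at this

/-- The operator used to isolate the pole of the Weyl function at `lam₀`. -/
def poleOp (V : ℝ → A) (hV : IntervalIntegrable V volume 0 1) (lam₀ : ℝ) (p : A) (lam : ℂ) : A :=
  p * (∫ t in (0 : ℝ)..1, star (sol V hV 0 1 lam₀ t) * sol V hV 0 1 lam t) +
    star (charFun V hV lam₀) * charFun V hV lam

lemma differentiable_integral_mul_sol {g : ℝ → A} (hg : Continuous g) (a b : A) :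
    Differentiable ℂ (fun lam => ∫ t in (0 : ℝ)..1, g t * sol V hV a b lam t) := by
  have hg' : IntervalIntegrable g volume 0 1 := hg.intervalIntegrable _ _
  exact (ContinuousMap.evalCLM ℂ (⟨1, unitInterval.one_mem⟩ : Icc (0 : ℝ) 1) :
    C(Icc (0 : ℝ) 1, A) →L[ℂ] A).differentiable.comp
      ((volterra g hg').differentiable.comp (differentiable_solC hV a b))

lemma continuous_star_sol (lam : ℂ) : Continuous (fun t => star (sol V hV 0 1 lam t)) :=
  (continuous_sol hV 0 1 lam).star

lemma differentiable_poleOp (lam₀ : ℝ) (p : A) : Differentiable ℂ (poleOp V hV lam₀ p) :=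
  ((differentiable_const p).mul
    (differentiable_integral_mul_sol hV (continuous_star_sol hV lam₀) 0 1)).add
    ((differentiable_const _).mul (differentiable_charFun hV))

lemma intervalIntegrable_star_sol_mul_sol (mu lam : ℂ) (a b : A) :
    IntervalIntegrable (fun t => star (sol V hV 0 1 mu t) * sol V hV a b lam t) volume 0 1 :=
  Continuous.intervalIntegrable ((continuous_star_sol hV mu).mul (continuous_sol hV a b lam)) 0 1

lemma proj_mul_star_charFun {lam₀ : ℝ} {p : A} (hp : star p = p)
    (hp0 : charFun V hV lam₀ * p = 0) : p * star (charFun V hV lam₀) = 0 := by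
  rw [← hp, ← star_mul, hp0, star_zero]

/-- Lagrange identity between `Y` and `φ(·, lam₀)`. The boundary term at `1` is `Δ(lam₀)* Y'(1)`,
which `p` annihilates; the one at `0` is `-Y(0)`. -/
lemma proj_mul_init_eq (hs : ∀ᵐ x, x ∈ Ioc (0 : ℝ) 1 → star (V x) = V x) {lam₀ : ℝ} {p : A}
    (hp : star p = p) (hp0 : charFun V hV lam₀ * p = 0) {lam : ℂ} {Y Y' : ℝ → A}
    (hY : Sol V lam Y Y') (h1 : Y 1 = 0) :
    p * Y 0 = ((lam₀ : ℂ) - lam) •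
      (p * ∫ t in (0 : ℝ)..1, star (sol V hV 0 1 lam₀ t) * Y t) := by
  have h := (hY.lagrange hs (sol_isSol hV 0 1 (lam₀ : ℂ))).eq 1 unitInterval.one_mem
  rw [intervalIntegral.integral_smul] at h
  have h' := congrArg (fun a => p * a) h
  simp only [mul_add, h1, mul_zero, sub_zero, sol_zero, dsol_zero, star_zero, zero_mul,
    star_one, one_mul, zero_sub] at h'
  rw [← charFun, ← mul_assoc, proj_mul_star_charFun hV hp hp0, zero_mul, mul_neg,
    mul_smul_comm, Complex.star_def, Complex.conj_ofReal] at h'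
  exact (neg_add_eq_zero.1 h'.symm)

/-- If `Δ(lam) m = 0`, then `φ m` vanishes at both ends, and `proj_mul_init_eq` kills the integral
part of `poleOp` on `m` as well. -/
lemma isUnit_charFun_of_isUnit_poleOp [FiniteDimensional ℂ A]
    (hs : ∀ᵐ x, x ∈ Ioc (0 : ℝ) 1 → star (V x) = V x) {lam₀ : ℝ} {p : A}
    (hp : star p = p) (hp0 : charFun V hV lam₀ * p = 0) {lam : ℂ} (hlam : lam ≠ lam₀)
    (hC : IsUnit (poleOp V hV lam₀ p lam)) : IsUnit (charFun V hV lam) := by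
  refine isUnit_of_mul_eq_zero fun m hm => ?_
  have hY := (sol_isSol hV 0 1 lam).mul_const m
  have h := proj_mul_init_eq hV hs hp hp0 hY hm
  simp only [sol_zero, zero_mul, mul_zero] at h
  have h2 := (smul_eq_zero.1 h.symm).resolve_left (sub_ne_zero.2 hlam.symm)
  refine hC.mul_right_eq_zero.1 ?_
  rw [poleOp, add_mul, mul_assoc, mul_assoc, hm, mul_zero, add_zero]
  refine Eq.trans (congrArg (p * ·) ?_) h2
  have := ((IsPrim.integral 0 (intervalIntegrable_star_sol_mul_sol hV lam₀ lam 0 1)).mul_const m).eq 1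
    unitInterval.one_mem
  simpa [mul_assoc] using this

/-- The first part of `poleOp` is handled by `proj_mul_init_eq` for the Weyl solution, the second by
`Δ M = -θ(1)`. The only singular term left is `-p / (lam - lam₀)`. -/
lemma poleOp_mul_weylM (hs : ∀ᵐ x, x ∈ Ioc (0 : ℝ) 1 → star (V x) = V x) {lam₀ : ℝ} {p : A}
    (hp : star p = p) (hp0 : charFun V hV lam₀ * p = 0) {lam : ℂ} (hlam : lam ≠ lam₀)
    (hu : IsUnit (charFun V hV lam)) :
    poleOp V hV lam₀ p lam * weylM V hV lam = -((lam - lam₀)⁻¹ • p) -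
      p * (∫ t in (0 : ℝ)..1, star (sol V hV 0 1 lam₀ t) * sol V hV 1 0 lam t) -
      star (charFun V hV lam₀) * sol V hV 1 0 lam 1 := by
  have h := proj_mul_init_eq hV hs hp hp0 (weylSol_isSol hV lam) (weylSol_one hV hu)
  rw [weylSol_zero, mul_one] at h
  have h1 := (IsPrim.integral 0 (intervalIntegrable_star_sol_mul_sol hV lam₀ lam 0 1)).mul_const
    (weylM V hV lam)
  have h2 := IsPrim.integral 0 (intervalIntegrable_star_sol_mul_sol hV lam₀ lam 1 0)
  have h3 := (h2.add h1).eq 1 unitInterval.one_mem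
  simp only [zero_add, intervalIntegral.integral_same, zero_mul] at h3
  have h4 : ∫ t in (0 : ℝ)..1, star (sol V hV 0 1 lam₀ t) * weylSol V hV lam t =
      (∫ t in (0 : ℝ)..1, star (sol V hV 0 1 lam₀ t) * sol V hV 1 0 lam t) +
      (∫ t in (0 : ℝ)..1, star (sol V hV 0 1 lam₀ t) * sol V hV 0 1 lam t) * weylM V hV lam := by
    rw [h3]
    simp only [weylSol, mul_add, mul_assoc]
  rw [h4] at h
  have h5 : -((lam - lam₀)⁻¹ • p) =
      p * ((∫ t in (0 : ℝ)..1, star (sol V hV 0 1 lam₀ t) * sol V hV 1 0 lam t) +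
      (∫ t in (0 : ℝ)..1, star (sol V hV 0 1 lam₀ t) * sol V hV 0 1 lam t) *
        weylM V hV lam) := by
    nth_rw 1 [h]
    rw [smul_smul, ← neg_smul, ← mul_neg, neg_sub, inv_mul_cancel₀ (sub_ne_zero.2 hlam), one_smul]
  rw [h5, poleOp, add_mul, mul_assoc (star _), charFun_mul_weylM hV hu, mul_add, mul_neg,
    mul_assoc]
  abel

/-- Dividing `poleOp_mul_weylM` by `poleOp`, a unit near `lam₀`, shows at most a simple pole with
residue `-R`. That `lam₀` is an isolated point of non-invertibility, if one at all, comes out of the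
same argument. -/
lemma exists_bound_weylM_add [FiniteDimensional ℂ A]
    (hs : ∀ᵐ x, x ∈ Ioc (0 : ℝ) 1 → star (V x) = V x) {lam₀ : ℝ} {p R : A}
    (hp : star p = p) (hp0 : charFun V hV lam₀ * p = 0) (hC : IsUnit (poleOp V hV lam₀ p lam₀))
    (hR : poleOp V hV lam₀ p lam₀ * R = p) :
    (∀ᶠ lam in 𝓝[≠] (lam₀ : ℂ), IsUnit (charFun V hV lam)) ∧
    ∃ B, ∀ᶠ lam in 𝓝[≠] (lam₀ : ℂ), ‖weylM V hV lam + (lam - lam₀)⁻¹ • R‖ ≤ B := by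
  have hcont := (differentiable_poleOp hV lam₀ p).continuous
  have hCu : ∀ᶠ lam in 𝓝 (lam₀ : ℂ), IsUnit (poleOp V hV lam₀ p lam) := by
    obtain ⟨u, hu⟩ := hC
    have := hcont.continuousAt (x := (lam₀ : ℂ)).preimage_mem_nhds
      (by rw [← hu]; exact Units.nhds u)
    exact this
  have hne : ∀ᶠ lam in 𝓝[≠] (lam₀ : ℂ), lam ≠ (lam₀ : ℂ) := self_mem_nhdsWithin
  have hΔ : ∀ᶠ lam in 𝓝[≠] (lam₀ : ℂ), IsUnit (charFun V hV lam) := by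
    filter_upwards [hCu.filter_mono nhdsWithin_le_nhds, hne] with lam h1 h2
    exact isUnit_charFun_of_isUnit_poleOp hV hs hp hp0 h2 h1
  refine ⟨hΔ, ?_⟩
  -- Writing `p` as `poleOp` at `lam₀` times `R` turns the singular terms into a difference
  -- quotient, which has a limit.
  set T : ℂ → A := fun lam => (lam - lam₀)⁻¹ • (poleOp V hV lam₀ p lam * R -
      poleOp V hV lam₀ p lam₀ * R) -
      p * (∫ t in (0 : ℝ)..1, star (sol V hV 0 1 lam₀ t) * sol V hV 1 0 lam t) -
      star (charFun V hV lam₀) * sol V hV 1 0 lam 1 with hT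
  have hslope : Tendsto (fun lam : ℂ => (lam - lam₀)⁻¹ • (poleOp V hV lam₀ p lam * R -
      poleOp V hV lam₀ p lam₀ * R)) (𝓝[≠] (lam₀ : ℂ))
      (𝓝 (deriv (fun lam => poleOp V hV lam₀ p lam * R) lam₀)) :=
    hasDerivAt_iff_tendsto_slope.1 (((differentiable_poleOp hV lam₀ p).mul
      (differentiable_const R)) (lam₀ : ℂ)).hasDerivAt
  have hi := ((differentiable_const p).mul
    (differentiable_integral_mul_sol hV (continuous_star_sol hV lam₀) 1 0)).continuous.tendsto
    (lam₀ : ℂ)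
  have hth := ((differentiable_const (star (charFun V hV lam₀))).mul
    (differentiable_sol hV 1 0 1)).continuous.tendsto (lam₀ : ℂ)
  have hinv : ContinuousAt (fun lam => Ring.inverse (poleOp V hV lam₀ p lam)) (lam₀ : ℂ) :=
    ((differentiable_poleOp hV lam₀ p (lam₀ : ℂ)).inverse hC).continuousAt
  obtain ⟨l, hlim⟩ : ∃ l, Tendsto (fun lam => Ring.inverse (poleOp V hV lam₀ p lam) * T lam)
      (𝓝[≠] (lam₀ : ℂ)) (𝓝 l) :=
    ⟨_, (hinv.tendsto.mono_left nhdsWithin_le_nhds).mul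
      ((hslope.sub (hi.mono_left nhdsWithin_le_nhds)).sub (hth.mono_left nhdsWithin_le_nhds))⟩
  obtain ⟨B, hB⟩ := hlim.norm.isBoundedUnder_le
  refine ⟨B, ?_⟩
  filter_upwards [hB, hCu.filter_mono nhdsWithin_le_nhds, hne, hΔ] with lam h1 h2 h3 h4
  refine le_of_eq_of_le (congrArg norm ?_) h1
  have key : poleOp V hV lam₀ p lam * (weylM V hV lam + (lam - lam₀)⁻¹ • R) = T lam := by
    rw [mul_add, poleOp_mul_weylM hV hs hp hp0 h3 h4, mul_smul_comm]
    simp only [hT]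
    rw [hR, smul_sub]
    abel
  rw [← key, ← mul_assoc, Ring.inverse_mul_cancel _ h2, one_mul]

end Weyl

/-! ### Equal principal parts force equal potentials -/

section Uniqueness

variable {A : Type*} [NormedRing A] [NormedAlgebra ℂ A] [CompleteSpace A]
  [StarRing A] [NormedStarGroup A] [StarModule ℂ A]

variable {V W : ℝ → A} (hV : IntervalIntegrable V volume 0 1)
  (hW : IntervalIntegrable W volume 0 1)

/-- At every real point the Weyl functions of `V` and `W` have the same principal part: there is
a common projection onto the kernels of the characteristic functions and a common residue. -/
def SamePoles (V W : ℝ → A) (hV : IntervalIntegrable V volume 0 1)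
    (hW : IntervalIntegrable W volume 0 1) : Prop :=
  ∀ lam₀ : ℝ, ∃ p R : A, star p = p ∧ charFun V hV lam₀ * p = 0 ∧ charFun W hW lam₀ * p = 0 ∧
    IsUnit (poleOp V hV lam₀ p lam₀) ∧ IsUnit (poleOp W hW lam₀ p lam₀) ∧
    poleOp V hV lam₀ p lam₀ * R = p ∧ poleOp W hW lam₀ p lam₀ * R = p

/-- Schwarz reflection: conjugating both parameter and value preserves analyticity. -/
lemma differentiable_star_sol_star (a b : A) (x : ℝ) :
    Differentiable ℂ (fun lam => star (sol V hV a b (star lam) x)) := fun lam => by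
  have := (differentiable_sol hV a b x (star lam)).star_star
  rwa [star_star] at this

lemma differentiable_star_dsol_star (a b : A) (x : ℝ) :
    Differentiable ℂ (fun lam => star (dsol V hV a b (star lam) x)) := fun lam => by
  have := (differentiable_dsol hV a b x (star lam)).star_star
  rwa [star_star] at this

/-- Subtracting the equations, `(W - V) φ` has zero integral over every `[0, x]`, so it vanishes
almost everywhere; at the nonreal parameter `i`, `φ(x)` is invertible for all `x > 0`. -/
lemma ae_eq_of_sol_eq [FiniteDimensional ℂ A] (hA : IntegralDefinite A)
    (hVs : ∀ᵐ x, x ∈ Ioc (0 : ℝ) 1 → star (V x) = V x)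
    (h : ∀ x ∈ Icc (0 : ℝ) 1, sol W hW 0 1 Complex.I x = sol V hV 0 1 Complex.I x) :
    ∀ᵐ x, x ∈ Ioo (0 : ℝ) 1 → W x = V x := by
  have sV := sol_isSol hV 0 1 Complex.I
  have sW := sol_isSol hW 0 1 Complex.I
  have hd : ∀ x ∈ Icc (0 : ℝ) 1, dsol W hW 0 1 Complex.I x = dsol V hV 0 1 Complex.I x := by
    intro x hx
    have h1 := sW.prim.hasDerivWithinAt sW.prim'.continuousOn hx
    have h2 := (sV.prim.hasDerivWithinAt sV.prim'.continuousOn hx).congr h (h x hx)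
    exact (uniqueDiffOn_Icc one_pos x hx).eq_deriv _ h1 h2
  have hdiff := (sW.prim'.sub sV.prim').congr (G := fun _ => 0)
    (g := fun x => (W x - V x) * sol V hV 0 1 Complex.I x)
    (fun x hx => by rw [hd x hx, sub_self]) (fun x hx => by rw [h x hx, sub_mul]; abel)
  filter_upwards [hdiff.int.ae_hasDerivAt_integral] with x hx hx01
  have hx' : x ∈ uIcc (0 : ℝ) 1 := by
    rw [uIcc_of_le zero_le_one]; exact Ioo_subset_Icc_self hx01
  have h1 := hx hx' 0 (by simp)
  have h2 : HasDerivAt (fun _ : ℝ => (0 : A))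
      ((W x - V x) * sol V hV 0 1 Complex.I x) x := by
    refine h1.congr_of_eventuallyEq ?_
    filter_upwards [Icc_mem_nhds hx01.1 hx01.2] with y hy
    have := hdiff.eq y hy
    rwa [zero_add] at this
  have h3 := h2.unique (hasDerivAt_const x 0)
  have hu := isUnit_sol_of_im_ne_zero hV hA hVs (lam := Complex.I) (by simp)
    (Ioo_subset_Ioc_self hx01)
  exact sub_eq_zero.1 (hu.mul_left_eq_zero.1 h3)

variable [FiniteDimensional ℂ A] (hA : IntegralDefinite A)
  (hVs : ∀ᵐ x, x ∈ Ioc (0 : ℝ) 1 → star (V x) = V x)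
  (hWs : ∀ᵐ x, x ∈ Ioc (0 : ℝ) 1 → star (W x) = W x)
  (hpoles : SamePoles V W hV hW)

include hA hVs hWs hpoles

/-- The difference of the Weyl functions extends to an entire function. -/
lemma exists_entire_weylM_sub : ∃ D : ℂ → A, Differentiable ℂ D ∧
    ∀ lam, IsUnit (charFun V hV lam) → IsUnit (charFun W hW lam) →
      D lam = weylM W hW lam - weylM V hV lam := by
  have hdiff : ∀ lam, IsUnit (charFun V hV lam) → IsUnit (charFun W hW lam) →
      DifferentiableAt ℂ (fun lam => weylM W hW lam - weylM V hV lam) lam := fun lam h1 h2 =>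
    (differentiableAt_weylM hW h2).fun_sub (differentiableAt_weylM hV h1)
  have hnon : ∀ c : ℂ, c.im ≠ 0 →
      DifferentiableAt ℂ (fun lam => weylM W hW lam - weylM V hV lam) c := fun c hc =>
    hdiff c (isUnit_sol_of_im_ne_zero hV hA hVs hc (by simp))
      (isUnit_sol_of_im_ne_zero hW hA hWs hc (by simp))
  have main : ∀ c : ℂ,
      (∀ᶠ z in 𝓝[≠] c, DifferentiableAt ℂ (fun lam => weylM W hW lam - weylM V hV lam) z) ∧
      ∃ B, ∀ᶠ z in 𝓝[≠] c, ‖weylM W hW z - weylM V hV z‖ ≤ B := by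
    intro c
    by_cases hc : c.im = 0
    · obtain ⟨lam₀, rfl⟩ : ∃ lam₀ : ℝ, c = lam₀ := ⟨c.re, Complex.ext rfl (by simp [hc])⟩
      obtain ⟨p, R, hp, hpV, hpW, huV, huW, hRV, hRW⟩ := hpoles lam₀
      obtain ⟨hV1, B1, hB1⟩ := exists_bound_weylM_add hV hVs hp hpV huV hRV
      obtain ⟨hW1, B2, hB2⟩ := exists_bound_weylM_add hW hWs hp hpW huW hRW
      refine ⟨?_, B2 + B1, ?_⟩
      · filter_upwards [hV1, hW1] with z h1 h2 using hdiff z h1 h2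
      · filter_upwards [hB1, hB2] with z h1 h2
        -- The common singular term is added to both Weyl functions, and each sum is bounded.
        rw [← add_sub_add_right_eq_sub (weylM W hW z) _ ((z - lam₀)⁻¹ • R)]
        exact (norm_sub_le _ _).trans (add_le_add h2 h1)
    · have hopen : ∀ᶠ z : ℂ in 𝓝 c, z.im ≠ 0 :=
        (Complex.continuous_im.continuousAt (x := c)).eventually_ne hc
      refine ⟨(hopen.filter_mono nhdsWithin_le_nhds).mono hnon, ?_⟩
      obtain ⟨B, hB⟩ := ((hnon c hc).continuousAt.tendsto.mono_left
        (nhdsWithin_le_nhds (s := {c}ᶜ))).norm.isBoundedUnder_le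
      exact ⟨B, hB⟩
  obtain ⟨D, hD, hDe⟩ := exists_entire_extension (fun c => (main c).1) (fun c => (main c).2)
  exact ⟨D, hD, fun lam h1 h2 => hDe lam (hdiff lam h1 h2)⟩

/-- `F₀` and `F₁` are the two quantities of `norm_transition_le`, expanded by `Ψ = θ + φ M` with
`M_W - M_V` replaced by the entire `D`. They are therefore entire, small on large circles, and zero.
-/
lemma sol_eq_of_samePoles [NormOneClass A] (lam : ℂ) {x : ℝ} (hx : x ∈ Icc (0 : ℝ) 1) :
    sol W hW 0 1 lam x = sol V hV 0 1 lam x := by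
  obtain ⟨D, hD, hDe⟩ := exists_entire_weylM_sub hV hW hA hVs hWs hpoles
  set Q := max (∫ t in (0 : ℝ)..1, ‖V t‖) (∫ t in (0 : ℝ)..1, ‖W t‖) with hQ
  obtain ⟨n₀, hn₀⟩ := eventually_atTop.1 (tendsto_radius.eventually_ge_atTop (16 * Q))
  set F₀ : ℂ → A := fun lam => sol W hW 1 0 lam x * star (sol V hV 0 1 (star lam) x) -
    sol W hW 0 1 lam x * star (sol V hV 1 0 (star lam) x) +
    sol W hW 0 1 lam x * D lam * star (sol V hV 0 1 (star lam) x) with hF₀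
  set F₁ : ℂ → A := fun lam => sol W hW 0 1 lam x * star (dsol V hV 1 0 (star lam) x) -
    sol W hW 1 0 lam x * star (dsol V hV 0 1 (star lam) x) -
    sol W hW 0 1 lam x * D lam * star (dsol V hV 0 1 (star lam) x) + 1 with hF₁
  have dF₀ : Differentiable ℂ F₀ :=
    (((differentiable_sol hW 1 0 x).mul (differentiable_star_sol_star hV 0 1 x)).sub
      ((differentiable_sol hW 0 1 x).mul (differentiable_star_sol_star hV 1 0 x))).add
      (((differentiable_sol hW 0 1 x).mul hD).mul (differentiable_star_sol_star hV 0 1 x))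
  have dF₁ : Differentiable ℂ F₁ :=
    ((((differentiable_sol hW 0 1 x).mul (differentiable_star_dsol_star hV 1 0 x)).sub
      ((differentiable_sol hW 1 0 x).mul (differentiable_star_dsol_star hV 0 1 x))).sub
      (((differentiable_sol hW 0 1 x).mul hD).mul
        (differentiable_star_dsol_star hV 0 1 x))).add (differentiable_const 1)
  have bound : ∀ n ≥ n₀, ∀ lam : ℂ, ‖lam‖ = radius n ^ 2 →
      ‖F₀ lam‖ ≤ (320 * Q ^ 2 + 176 * Q) / radius n ∧
      ‖F₁ lam‖ ≤ (320 * Q ^ 2 + 176 * Q) / radius n := by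
    intro n hn lam hlam
    obtain ⟨k, rfl, hk⟩ := exists_sq_eq_of_norm_eq (by linarith [one_lt_radius n]) hlam
    have hks : ‖star k‖ = radius n := by rw [norm_star, hk]
    have hkQ := hn₀ n hn
    have uV := isUnit_charFun_of_circle hV (le_max_left _ _) hk hkQ
    have uW := isUnit_charFun_of_circle hW (le_max_right _ _) hk hkQ
    have uVs := isUnit_charFun_of_circle hV (le_max_left _ _) hks hkQ
    have b := norm_transition_le hV hW (le_max_left _ _) (le_max_right _ _) hk hkQ
      (sol_isSol hW 0 1 (k ^ 2)) (sol_zero ..) (dsol_zero ..)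
      (weylSol_isSol hW (k ^ 2)) (weylSol_zero ..) (weylSol_one hW uW)
      (sol_isSol hV 0 1 (star k ^ 2)) (sol_zero ..) (dsol_zero ..)
      (weylSol_isSol hV (star k ^ 2)) (weylSol_zero ..) (weylSol_one hV uVs) hx
    have hM : star (weylM V hV (star k ^ 2)) = weylM V hV (k ^ 2) := by
      rw [← star_pow] at uVs ⊢
      exact star_weylM hV hVs uV uVs
    have hDk := hDe _ uV uW
    rw [weylSol, weylSol, dweylSol, star_add, star_add, star_mul, star_mul, hM] at b
    refine ⟨le_of_eq_of_le (congrArg norm ?_) b.1, le_of_eq_of_le (congrArg norm ?_) b.2⟩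
    · simp only [hF₀, hDk, star_pow]
      noncomm_ring
    · simp only [hF₁, hDk, star_pow]
      noncomm_ring
  have z₀ : F₀ lam = 0 := eq_zero_of_circle_bound dF₀ (fun n hn z hz => (bound n hn z hz).1) lam
  have z₁ : F₁ lam = 0 := eq_zero_of_circle_bound dF₁ (fun n hn z hz => (bound n hn z hz).2) lam
  have w₁ := (sol_isSol hV 0 1 lam).wronskian_eq hVs (star_star lam)
    (sol_isSol hV 0 1 (star lam)) hx
  have w₂ := (sol_isSol hV 0 1 lam).wronskian_eq hVs (star_star lam)
    (sol_isSol hV 1 0 (star lam)) hx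
  simp only [sol_zero, dsol_zero, star_zero, star_one, mul_zero, sub_zero,
    mul_one] at w₁ w₂
  simp only [hF₀] at z₀
  simp only [hF₁] at z₁
  generalize sol W hW 0 1 lam x = φW at *
  generalize sol W hW 1 0 lam x = θW at *
  generalize sol V hV 0 1 lam x = φ at *
  generalize dsol V hV 0 1 lam x = φ' at *
  generalize star (sol V hV 0 1 (star lam) x) = f at *
  generalize star (dsol V hV 0 1 (star lam) x) = f' at *
  generalize star (sol V hV 1 0 (star lam) x) = t at *
  generalize star (dsol V hV 1 0 (star lam) x) = t' at *
  -- This is `F₁ φ + F₀ φ'`. The Wronskians `t φ' - t' φ = 1` and `f φ' - f' φ = 0` reduce it to `φ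
  -- - φW`.
  have e : (φW * t' - θW * f' - φW * D lam * f' + 1) * φ + (θW * f - φW * t + φW * D lam * f) * φ'
      = φ - φW * (t * φ' - t' * φ) + θW * (f * φ' - f' * φ) +
        φW * D lam * (f * φ' - f' * φ) := by
    noncomm_ring
  rw [z₀, z₁, w₁, w₂] at e
  simp only [zero_mul, add_zero, mul_zero, mul_one] at e
  exact (sub_eq_zero.1 e.symm).symm

theorem ae_eq_of_samePoles [NormOneClass A] : ∀ᵐ x, x ∈ Ioo (0 : ℝ) 1 → W x = V x :=
  ae_eq_of_sol_eq hV hW hA hVs fun _ hx =>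
    sol_eq_of_samePoles hV hW hA hVs hWs hpoles Complex.I hx

end Uniqueness

/-! ### The residue from the projection and the norming operator -/

section Residue

variable {A : Type*} [NormedRing A] [NormedAlgebra ℂ A] [CompleteSpace A]
  [StarRing A] [CStarRing A] [StarModule ℂ A] [FiniteDimensional ℂ A]

variable {V W : ℝ → A} (hV : IntervalIntegrable V volume 0 1)
  (hW : IntervalIntegrable W volume 0 1)

/-- The matrix `∫₀¹ φ* φ` for the sine solution `φ`. -/
def gram (V : ℝ → A) (hV : IntervalIntegrable V volume 0 1) (lam : ℝ) : A :=
  ∫ t in (0 : ℝ)..1, star (sol V hV 0 1 lam t) * sol V hV 0 1 lam t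

lemma poleOp_self (lam : ℝ) (p : A) : poleOp V hV lam p lam =
    p * gram V hV lam + star (charFun V hV lam) * charFun V hV lam := rfl

lemma eq_zero_of_star_mul_self_mul {a m : A} (h : star a * a * m = 0) : a * m = 0 := by
  rw [← CStarRing.star_mul_self_eq_zero_iff, star_mul, mul_assoc, ← mul_assoc (star a), h,
    mul_zero]

/-- Since `p Δ* = 0`, multiplying by `p` isolates the first summand of `poleOp`; what remains is `Δ*
Δ m = 0`, hence `Δ m = 0`. -/
lemma proj_mul_gram_mul {lam : ℝ} {p m q : A} (hp : star p = p) (hpp : p * p = p)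
    (hp0 : charFun V hV lam * p = 0) (h : poleOp V hV lam p lam * m = p * q) :
    p * gram V hV lam * m = p * q ∧ charFun V hV lam * m = 0 := by
  have h1 : p * gram V hV lam * m = p * q := by
    have := congrArg (fun a => p * a) h
    simp only [poleOp_self, add_mul, mul_add] at this
    rwa [mul_assoc (star _), ← mul_assoc p (star _), proj_mul_star_charFun hV hp hp0, zero_mul,
      add_zero, ← mul_assoc, ← mul_assoc, hpp, ← mul_assoc, hpp] at this
  refine ⟨h1, eq_zero_of_star_mul_self_mul ?_⟩
  rwa [poleOp_self, add_mul, h1, add_eq_left] at h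

/-- An annihilated `m` satisfies `Δ m = 0`, so `p m = m`, and then `m* S m = 0`. This is `∫ (φ m)*
(φ m) = 0`, so `φ m = 0` and `m = 0`. -/
lemma isUnit_poleOp (hA : IntegralDefinite A) {lam : ℝ} {p : A} (hp : star p = p)
    (hpp : p * p = p) (hp0 : charFun V hV lam * p = 0)
    (hker : ∀ m, charFun V hV lam * m = 0 → p * m = m) : IsUnit (poleOp V hV lam p lam) := by
  refine isUnit_of_mul_eq_zero fun m hm => ?_
  obtain ⟨h1, h2⟩ := proj_mul_gram_mul hV hp hpp hp0 (q := 0) (by rw [hm, mul_zero])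
  rw [mul_zero] at h1
  have hpm := hker m h2
  have h3 : star m * gram V hV lam * m = 0 := by
    rw [← hpm, star_mul, hp, mul_assoc (star m), mul_assoc (star m), hpm, h1, mul_zero]
  have hY := (sol_isSol hV 0 1 (lam : ℂ)).mul_const m
  have h4 : ∫ t in (0 : ℝ)..1, star (sol V hV 0 1 lam t * m) * (sol V hV 0 1 lam t * m) = 0 := by
    have e := (((IsPrim.integral 0 (intervalIntegrable_star_sol_mul_sol hV lam lam 0 1)).const_mul
      (star m)).mul_const m).eq 1 unitInterval.one_mem
    simp only [zero_add, intervalIntegral.integral_same, mul_zero, zero_mul] at e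
    rw [gram] at h3
    rw [h3] at e
    refine Eq.trans ?_ e.symm
    simp only [star_mul, mul_assoc]
  have h5 := hY.deriv_zero_eq_zero (x := 1) (by simp)
    (hA _ 1 hY.prim.continuousOn (by simp) h4)
  rwa [dsol_zero, one_mul] at h5

/-- The kernel projection and the compressed Gram matrix determine the principal parts of the
Weyl function. -/
lemma samePoles_of_proj (hA : IntegralDefinite A)
    (h : ∀ lam : ℝ, ∃ p : A, star p = p ∧ p * p = p ∧ charFun V hV lam * p = 0 ∧
      charFun W hW lam * p = 0 ∧ (∀ m, charFun V hV lam * m = 0 → p * m = m) ∧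
      (∀ m, charFun W hW lam * m = 0 → p * m = m) ∧
      p * gram V hV lam * p = p * gram W hW lam * p) : SamePoles V W hV hW := by
  intro lam
  obtain ⟨p, hp, hpp, hpV, hpW, hkV, hkW, hg⟩ := h lam
  have uV := isUnit_poleOp hV hA hp hpp hpV hkV
  have uW := isUnit_poleOp hW hA hp hpp hpW hkW
  have hR : poleOp V hV lam p lam * (Ring.inverse (poleOp V hV lam p lam) * p) = p := by
    rw [← mul_assoc, Ring.mul_inverse_cancel _ uV, one_mul]
  refine ⟨p, _, hp, hpV, hpW, uV, uW, hR, ?_⟩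
  set R := Ring.inverse (poleOp V hV lam p lam) * p
  obtain ⟨h1, h2⟩ := proj_mul_gram_mul hV hp hpp hpV (m := R) (q := p) (by rw [hR, hpp])
  -- As `R = p R`, `poleOp` acts on `R` through `p S p` alone, which is common to both potentials.
  have hpR := hkV R h2
  rw [← hpR, ← mul_assoc, hpp] at h1
  rw [poleOp_self, add_mul, ← hpR, mul_assoc (star _), ← mul_assoc (charFun W hW lam), hpW,
    zero_mul, mul_zero, add_zero, ← mul_assoc, ← hg]
  exact h1

end Residue

/-! ### Passage from the abstract algebra to matrices -/

section Matrices

open scoped Matrix.Norms.L2Operator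

variable {N : ℕ}

lemma IsPrim.fun_sum {ι E : Type*} [NormedAddCommGroup E] [NormedSpace ℝ E] (s : Finset ι)
    {F f : ι → ℝ → E} (h : ∀ i, IsPrim (F i) (f i)) :
    IsPrim (fun x => ∑ i ∈ s, F i x) (fun x => ∑ i ∈ s, f i x) := by
  classical
  induction s using Finset.induction_on with
  | empty => simpa using IsPrim.const (0 : E)
  | insert a s ha ih =>
    simp only [Finset.sum_insert ha]
    exact (h a).add ih

/-- The `(i, j)` entry as a continuous linear map. -/
def entryCLM (i j : Fin N) : Matrix (Fin N) (Fin N) ℂ →L[ℝ] ℂ :=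
  LinearMap.toContinuousLinearMap
    { toFun := fun m => m i j, map_add' := fun _ _ => rfl, map_smul' := fun _ _ => rfl }

lemma entryCLM_apply (i j : Fin N) (m : Matrix (Fin N) (Fin N) ℂ) : entryCLM i j m = m i j := rfl

/-- The matrix with a single entry as a continuous linear map. -/
def singleCLM (i j : Fin N) : ℂ →L[ℝ] Matrix (Fin N) (Fin N) ℂ :=
  LinearMap.toContinuousLinearMap
    { toFun := fun z => Matrix.single i j z
      map_add' := fun _ _ => Matrix.single_add _ _ _ _
      map_smul' := fun _ _ => by simp [Matrix.smul_single] }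

lemma sum_singleCLM (m : Matrix (Fin N) (Fin N) ℂ) : ∑ i, ∑ j, singleCLM i j (m i j) = m :=
  (Matrix.matrix_eq_sum_single m).symm

lemma isPrim_matrix_iff {F f : ℝ → Matrix (Fin N) (Fin N) ℂ} :
    IsPrim F f ↔ ∀ i j, IsPrim (fun x => F x i j) (fun x => f x i j) := by
  refine ⟨fun h i j => h.clm (entryCLM i j), fun h => ?_⟩
  have := IsPrim.fun_sum Finset.univ fun i => IsPrim.fun_sum Finset.univ fun j =>
    (h i j).clm (singleCLM i j)
  exact this.congr (fun x _ => sum_singleCLM (F x)) fun x _ => sum_singleCLM (f x)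

lemma isPrim_pi_iff {F f : ℝ → Fin N → ℂ} :
    IsPrim F f ↔ ∀ i, IsPrim (fun x => F x i) (fun x => f x i) := by
  refine ⟨fun h i => h.clm (ContinuousLinearMap.proj i), fun h => ?_⟩
  have := IsPrim.fun_sum Finset.univ fun i =>
    (h i).clm (ContinuousLinearMap.single ℝ (fun _ : Fin N => ℂ) i)
  exact this.congr (fun x _ => Finset.univ_sum_single (F x)) fun x _ =>
    Finset.univ_sum_single (f x)

lemma isSolution_iff {V : ℝ → Matrix (Fin N) (Fin N) ℂ} {lam : ℂ} {ψ dψ : ℝ → Fin N → ℂ} :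
    IsSolution V lam ψ dψ ↔ IsPrim ψ dψ ∧ IsPrim dψ (fun t => V t *ᵥ ψ t - lam • ψ t) := by
  constructor
  · intro h
    have h2 : IsPrim dψ (fun t => V t *ᵥ ψ t - lam • ψ t) := ⟨h.integrable, h.integral_eq⟩
    exact ⟨IsPrim.of_hasDerivWithinAt h.hasDeriv h2.continuousOn, h2⟩
  · rintro ⟨h1, h2⟩
    exact ⟨fun x hx => h1.hasDerivWithinAt h2.continuousOn hx, h2.int, h2.eq⟩

lemma sol_iff_columns {V : ℝ → Matrix (Fin N) (Fin N) ℂ} {lam : ℂ}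
    {Y Y' : ℝ → Matrix (Fin N) (Fin N) ℂ} :
    Sol V lam Y Y' ↔ ∀ j, IsSolution V lam (fun x i => Y x i j) (fun x i => Y' x i j) := by
  have key : Sol V lam Y Y' ↔
      IsPrim Y Y' ∧ IsPrim Y' (fun t => V t * Y t - lam • Y t) := ⟨fun h => ⟨h.1, h.2⟩,
    fun h => ⟨h.1, h.2⟩⟩
  simp only [key, isSolution_iff, isPrim_matrix_iff, isPrim_pi_iff]
  constructor
  · rintro ⟨h1, h2⟩ j
    exact ⟨fun i => h1 i j, fun i => h2 i j⟩
  · intro h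
    exact ⟨fun i j => (h j).1 i, fun i j => (h j).2 i⟩

variable {V : ℝ → Matrix (Fin N) (Fin N) ℂ}

lemma IsPotential.intervalIntegrable (h : IsPotential V) : IntervalIntegrable V volume 0 1 := by
  have h1 : ∀ i j, IntervalIntegrable (fun x => V x i j) volume 0 1 := fun i j => by
    rw [intervalIntegrable_iff_integrableOn_Ioo_of_le zero_le_one]
    exact h.integrable i j
  -- The entrywise primitive is assembled only to read off integrability in the matrix norm.
  have h2 : IsPrim (fun x => Matrix.of fun i j => 0 + ∫ t in (0 : ℝ)..x, V t i j) V :=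
    isPrim_matrix_iff.2 fun i j => IsPrim.integral 0 (h1 i j)
  exact h2.int

lemma IsPotential.star_eq (h : IsPotential V) :
    ∀ᵐ x, x ∈ Ioc (0 : ℝ) 1 → star (V x) = V x := by
  have := h.selfAdjoint
  rw [restrict_Ioo_eq_restrict_Ioc, ae_restrict_iff' measurableSet_Ioc] at this
  exact this

/-- The diagonal entries of `Y* Y` are the squared norms of the columns: continuous and nonnegative,
so zero integral makes them vanish. -/
lemma integralDefinite_matrix : IntegralDefinite (Matrix (Fin N) (Fin N) ℂ) := by
  intro Y x hY hx h
  have hx' : x ∈ Icc (0 : ℝ) 1 := ⟨hx.1.le, hx.2⟩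
  have hYi : IntervalIntegrable (fun t => star (Y t) * Y t) volume 0 1 :=
    ContinuousOn.intervalIntegrable (by
      rw [uIcc_of_le zero_le_one]; exact hY.star.mul hY)
  have h1 := intervalIntegrable_sub hYi unitInterval.zero_mem hx'
  have h2 : ∀ j, ∫ t in (0 : ℝ)..x, ∑ i, ‖Y t i j‖ ^ 2 = 0 := by
    intro j
    have e := (entryCLM j j).intervalIntegral_comp_comm h1
    rw [h, map_zero] at e
    have e2 : ∀ t, entryCLM j j (star (Y t) * Y t) = ((∑ i, ‖Y t i j‖ ^ 2 : ℝ) : ℂ) := by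
      intro t
      rw [entryCLM_apply, Matrix.mul_apply]
      push_cast
      refine Finset.sum_congr rfl fun i _ => ?_
      rw [Matrix.star_apply, Complex.star_def, Complex.conj_mul']
    simp only [e2] at e
    rw [intervalIntegral.integral_ofReal] at e
    exact_mod_cast e
  have hcont : ∀ i j, ContinuousOn (fun t => Y t i j) (Icc 0 x) := fun i j =>
    ((entryCLM i j).continuous.comp_continuousOn hY).mono (Icc_subset_Icc_right hx.2)
  intro t ht
  ext i j
  have h3 : ∑ i, ‖Y t i j‖ ^ 2 = 0 := by
    by_contra hne
    have hpos := intervalIntegral.integral_pos (f := fun t => ∑ i, ‖Y t i j‖ ^ 2) hx.1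
      (continuousOn_finsetSum _ fun i _ => ((hcont i j).norm.pow 2))
      (fun s _ => Finset.sum_nonneg fun i _ => by positivity)
      ⟨t, ht, lt_of_le_of_ne (Finset.sum_nonneg fun i _ => by positivity) (Ne.symm hne)⟩
    exact hpos.ne' (h2 j)
  have h4 := (Finset.sum_eq_zero_iff_of_nonneg (fun i _ => by positivity)).1 h3 i
    (Finset.mem_univ i)
  simpa using h4

variable (hV : IntervalIntegrable V volume 0 1)

lemma isSineSolution_iff {lam : ℂ} {Φ : ℝ → Matrix (Fin N) (Fin N) ℂ} :
    IsSineSolution V lam Φ ↔ ∃ dΦ, Sol V lam Φ dΦ ∧ Φ 0 = 0 ∧ dΦ 0 = 1 := by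
  simp only [IsSineSolution, sol_iff_columns]

/-- Existence makes the choice in `phi` a genuine solution; uniqueness identifies it on `[0,1]`. -/
lemma phi_eq_sol (lam : ℂ) {x : ℝ} (hx : x ∈ Icc (0 : ℝ) 1) :
    phi V lam x = sol V hV 0 1 lam x := by
  have h : IsSineSolution V lam (phi V lam) := Classical.epsilon_spec
    ⟨sol V hV 0 1 lam, isSineSolution_iff.2
      ⟨_, sol_isSol hV 0 1 lam, sol_zero .., dsol_zero ..⟩⟩
  obtain ⟨dΦ, h1, h2, h3⟩ := isSineSolution_iff.1 h
  rw [h1.eq_sol hV hx, h2, h3]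

lemma phi_one (lam : ℂ) : phi V lam 1 = charFun V hV lam :=
  phi_eq_sol hV lam unitInterval.one_mem

lemma S_eq_gram (lam : ℝ) : S V lam = gram V hV lam := by
  ext i j
  have e := (entryCLM i j).intervalIntegral_comp_comm
    (intervalIntegrable_star_sol_mul_sol hV lam lam 0 1)
  rw [gram, ← entryCLM_apply i j (∫ _ in _.._, _), ← e, S, Matrix.of_apply]
  refine intervalIntegral.integral_congr fun t ht => ?_
  rw [uIcc_of_le zero_le_one] at ht
  simp only [phi_eq_sol hV lam ht]
  rfl

end Matrices

/-! ### The spaces `E`, projections and norming operators in matrix form -/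

section SpectralData

open scoped Matrix.Norms.L2Operator

variable {N : ℕ} {V W : ℝ → Matrix (Fin N) (Fin N) ℂ}

lemma mem_E_iff (hV : IntervalIntegrable V volume 0 1) {lam : ℝ} {h : EuclideanSpace ℂ (Fin N)} :
    h ∈ E V lam ↔ Matrix.toEuclideanCLM (n := Fin N) (𝕜 := ℂ) (charFun V hV lam) h = 0 := by
  rw [E, phi_one hV, LinearMap.mem_ker, ← Matrix.coe_toEuclideanCLM_eq_toEuclideanLin]
  rfl

/-- For `v` in the kernel of `Δ`, `φ v` solves the Dirichlet problem, so it vanishes and `v = (φ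
v)'(0) = 0`. -/
lemma E_eq_bot (hV : IntervalIntegrable V volume 0 1) {lam : ℝ} (h : lam ∉ eigenvalues V) :
    E V lam = ⊥ := by
  have hbot : eigenspace V (lam : ℂ) = ⊥ := not_not.1 h
  rw [Submodule.eq_bot_iff]
  intro v hv
  -- All columns equal `v`, so that the algebra-valued solution theory applies to a vector.
  set m : Matrix (Fin N) (Fin N) ℂ := Matrix.of fun i _ => v i with hm
  have hΔ : charFun V hV lam * m = 0 := by
    rw [mem_E_iff hV] at hv
    have hv' := congrArg WithLp.ofLp hv
    rw [Matrix.ofLp_toEuclideanCLM] at hv'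
    ext i j
    have := congrFun hv' i
    exact this
  have hY := (sol_isSol hV 0 1 (lam : ℂ)).mul_const m
  have hcol := sol_iff_columns.1 hY
  have hzero : ∀ x ∈ Icc (0 : ℝ) 1, sol V hV 0 1 lam x * m = 0 := by
    intro x hx
    ext i j
    have hmem : (fun (y : Icc (0 : ℝ) 1) (i : Fin N) => (sol V hV 0 1 (lam : ℂ) y * m) i j) ∈
        eigenspace V (lam : ℂ) := by
      refine ⟨_, _, hcol j, ?_, ?_, fun _ => rfl⟩
      · funext i
        simp only [sol_zero, zero_mul, Matrix.zero_apply, Pi.zero_apply]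
      · funext i
        rw [← charFun, hΔ]
        rfl
    rw [hbot, Submodule.mem_bot] at hmem
    exact congrFun (congrFun hmem ⟨x, hx⟩) i
  have h0 := hY.deriv_zero_eq_zero (x := 1) (by simp) hzero
  rw [dsol_zero, one_mul] at h0
  ext i
  have := congrFun (congrFun h0 i) i
  exact this

/-- The matrix of the orthogonal projection onto `E V lam`. -/
def projMatrix (V : ℝ → Matrix (Fin N) (Fin N) ℂ) (lam : ℝ) : Matrix (Fin N) (Fin N) ℂ :=
  (Matrix.toEuclideanCLM (n := Fin N) (𝕜 := ℂ)).symm (E V lam).starProjection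

lemma toEuclideanCLM_projMatrix (lam : ℝ) :
    Matrix.toEuclideanCLM (n := Fin N) (𝕜 := ℂ) (projMatrix V lam) = (E V lam).starProjection :=
  (Matrix.toEuclideanCLM (n := Fin N) (𝕜 := ℂ)).apply_symm_apply _

lemma star_projMatrix (lam : ℝ) : star (projMatrix V lam) = projMatrix V lam := by
  apply EquivLike.injective (Matrix.toEuclideanCLM (n := Fin N) (𝕜 := ℂ))
  rw [map_star, toEuclideanCLM_projMatrix]
  exact isSelfAdjoint_starProjection _

lemma projMatrix_mul_self (lam : ℝ) : projMatrix V lam * projMatrix V lam = projMatrix V lam := by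
  apply EquivLike.injective (Matrix.toEuclideanCLM (n := Fin N) (𝕜 := ℂ))
  rw [map_mul, toEuclideanCLM_projMatrix]
  exact Submodule.isIdempotentElem_starProjection _

lemma charFun_mul_projMatrix (hV : IntervalIntegrable V volume 0 1) (lam : ℝ) :
    charFun V hV lam * projMatrix V lam = 0 := by
  apply EquivLike.injective (Matrix.toEuclideanCLM (n := Fin N) (𝕜 := ℂ))
  rw [map_mul, toEuclideanCLM_projMatrix, map_zero]
  refine ContinuousLinearMap.ext fun h => ?_
  have := (mem_E_iff hV).1 (Submodule.starProjection_apply_mem (E V lam) h)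
  rw [mul_apply_eq_comp, zero_apply]
  exact this

lemma projMatrix_mul_of_charFun_mul (hV : IntervalIntegrable V volume 0 1) (lam : ℝ)
    (m : Matrix (Fin N) (Fin N) ℂ) (hm : charFun V hV lam * m = 0) : projMatrix V lam * m = m := by
  apply EquivLike.injective (Matrix.toEuclideanCLM (n := Fin N) (𝕜 := ℂ))
  rw [map_mul, toEuclideanCLM_projMatrix]
  refine ContinuousLinearMap.ext fun h => ?_
  refine Submodule.starProjection_eq_self_iff.2 ((mem_E_iff hV).2 ?_)
  have := congrArg (fun a => Matrix.toEuclideanCLM (n := Fin N) (𝕜 := ℂ) a h) hm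
  rw [map_mul, map_zero, mul_apply_eq_comp, zero_apply] at this
  exact this

lemma toEuclideanLin_proj_gram_proj (hV : IntervalIntegrable V volume 0 1) (lam : ℝ) :
    Matrix.toEuclideanLin (projMatrix V lam * gram V hV lam * projMatrix V lam) = G V lam := by
  rw [← Matrix.coe_toEuclideanCLM_eq_toEuclideanLin, map_mul, map_mul, toEuclideanCLM_projMatrix,
    G, P, S_eq_gram hV, ← Matrix.coe_toEuclideanCLM_eq_toEuclideanLin]
  rfl

lemma P_apply_mem (lam : ℝ) (h : EuclideanSpace ℂ (Fin N)) : P V lam h ∈ E V lam :=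
  Submodule.starProjection_apply_mem _ h

/-- Since `G = G P`, the norming operator on `E` together with `P` determines `G` on the whole
space. -/
lemma G_apply (lam : ℝ) (h : EuclideanSpace ℂ (Fin N)) :
    G V lam h = g V lam ⟨P V lam h, P_apply_mem lam h⟩ := by
  have : P V lam (P V lam h) = P V lam h :=
    Submodule.starProjection_eq_self_iff.2 (P_apply_mem lam h)
  change G V lam h = G V lam (P V lam h)
  simp only [G, LinearMap.comp_apply, this]

end SpectralData

end MatrixSL

/-! ### Reduction of the theorem to equal principal parts -/

open MatrixSL in
open scoped Matrix.Norms.L2Operator in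
/-- Uniqueness: if `W ∈ Iso(V)` has, at every eigenvalue, the same subspace `E` and the same
norming operator `g` as `V`, then `W = V` in `L¹(0,1)`. -/
theorem theorem1p2 {N : ℕ} (V W : ℝ → Matrix (Fin N) (Fin N) ℂ)
    (hV : MatrixSL.IsPotential V) (hW : W ∈ MatrixSL.Iso V)
    (hE : ∀ lam ∈ MatrixSL.eigenvalues V, MatrixSL.E W lam = MatrixSL.E V lam)
    (hg : ∀ lam ∈ MatrixSL.eigenvalues V, ∀ (h : EuclideanSpace ℂ (Fin N))
      (hhW : h ∈ MatrixSL.E W lam) (hhV : h ∈ MatrixSL.E V lam),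
      (MatrixSL.g W lam ⟨h, hhW⟩ : EuclideanSpace ℂ (Fin N)) = MatrixSL.g V lam ⟨h, hhV⟩) :
    W =ᵐ[MeasureTheory.volume.restrict (Set.Ioo (0 : ℝ) 1)] V := by
  -- `‖1‖ = 1` fails for matrices of size `0`, so that case is separated.
  rcases Nat.eq_zero_or_pos N with rfl | hN
  · exact Filter.Eventually.of_forall fun x => Subsingleton.elim _ _
  have : Nonempty (Fin N) := ⟨⟨0, hN⟩⟩
  obtain ⟨hWp, hWe, -⟩ := hW
  have iV := hV.intervalIntegrable
  have iW := hWp.intervalIntegrable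
  -- Off the common spectrum both kernels are zero, so agreement extends to every real `lam`, as
  -- `SamePoles` demands.
  have hE' : ∀ lam, E W lam = E V lam := by
    intro lam
    by_cases hlam : lam ∈ eigenvalues V
    · exact hE lam hlam
    · rw [E_eq_bot iV hlam, E_eq_bot iW (hWe ▸ hlam)]
  have hp : ∀ lam, projMatrix W lam = projMatrix V lam := fun lam => by
    simp only [projMatrix, hE' lam]
  have hG : ∀ lam, G W lam = G V lam := by
    intro lam
    refine LinearMap.ext fun h => ?_
    by_cases hlam : lam ∈ eigenvalues V
    · have hP : P W lam h = P V lam h := by simp only [P, hE' lam]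
      have hm : P W lam h ∈ E V lam := hP ▸ P_apply_mem lam h
      rw [G_apply, G_apply, hg lam hlam _ (P_apply_mem lam h) hm]
      simp only [hP]
    · have hzero : ∀ (U : ℝ → Matrix (Fin N) (Fin N) ℂ), E U lam = ⊥ → G U lam h = 0 := by
        intro U hU
        have : G U lam h ∈ E U lam := Submodule.starProjection_apply_mem _ _
        rwa [hU, Submodule.mem_bot] at this
      rw [hzero W (E_eq_bot iW (hWe ▸ hlam)), hzero V (E_eq_bot iV hlam)]
  have hpoles : SamePoles V W iV iW := by
    refine samePoles_of_proj iV iW integralDefinite_matrix fun lam =>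
      ⟨projMatrix V lam, star_projMatrix lam, projMatrix_mul_self lam,
        charFun_mul_projMatrix iV lam, ?_, projMatrix_mul_of_charFun_mul iV lam, ?_, ?_⟩
    · rw [← hp lam]
      exact charFun_mul_projMatrix iW lam
    · rw [← hp lam]
      exact projMatrix_mul_of_charFun_mul iW lam
    · apply Matrix.toEuclideanLin.injective
      rw [toEuclideanLin_proj_gram_proj iV, ← hp lam, toEuclideanLin_proj_gram_proj iW, hG lam]
  have := ae_eq_of_samePoles iV iW integralDefinite_matrix hV.star_eq hWp.star_eq hpoles
  exact (MeasureTheory.ae_restrict_iff' measurableSet_Ioo).2 this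

end
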